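/- **Theorem 4.1.** Let $1\to U(1)\xrightarrow{\iota}\widehat G\xrightarrow{\rho}G\to 1$ be a central extension of Lie groups (possibly infinite dimensional, modelled on normed spaces) such that $\rho$ is a locally trivial principal $U(1)$-bundle, and let $\theta\in\Omega^1(\widehat G;i\mathbb R)$ be a connection form on it. Let $NG(p)=G^p$ and $N\bar G(p)=G^{p+1}$ be the simplicial manifolds with face maps $$\varepsilon_0(g_1,\dots,g_p)=(g_2,\dots,g_p),\quad \varepsilon_i(g_1,\dots,g_p)=(g_1,\dots,g_ig_{i+1},\dots,g_p)\ (0<i<p),\quad \varepsilon_p(g_1,\dots,g_p)=(g_1,\dots,g_{p-1}),$$ $$\bar\varepsilon_i(h_1,\dots,h_{p+1})=(h_1,\dots,h_i,h_{i+2},\dots,h_{p+1})\quad(0\le i\le p),$$ and let $\gamma:N\bar G\to NG$, $\gamma(h_1,\dots,h_{p+1})=(h_1h_2^{-1},\dots,h_ph_{p+1}^{-1})$. For a simplicial manifold $X$ let $\Omega^*(X)$ be the total complex of $\Omega^{p,q}(X)=\Omega^q(X_p)$ (complex valued forms) with differential $D=d'+d''$, where $d'=\sum_i(-1)^i\varepsilon_i^*$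 and $d''=(-1)^p d$ on $\Omega^{p,q}(X)$. There is exactly one smooth $2$-form $c_1(\theta)$ on $G$ with $\rho^*c_1(\theta)=\left(\frac{-1}{2\pi i}\right)d\theta$. Let $\hat s=1$ be the trivial section $$\hat s(g_1,g_2)=\hat g_2\otimes(\hat g_1\hat g_2)^{\otimes -1}\otimes\hat g_1\qquad(\rho(\hat g_j)=g_j)$$ of the $U(1)$-bundle $\delta\widehat G=\varepsilon_0^*\widehat G\otimes(\varepsilon_1^*\widehat G)^{\otimes-1}\otimes\varepsilon_2^*\widehat G$ over $NG(2)=G\times G$, and let $\bar s_\gamma=1$ be the trivial section $$\bar s_\gamma(h_1,h_2)=\hat h_2\otimes\hat g\otimes(\hat g\hat h_2)^{\otimes-1}\qquad(\rho(\hat h_2)=h_2,\ \rho(\hat g)=h_1h_2^{-1})$$ of the $U(1)$-bundle $\bar\delta_\gamma\widehat G=\bar\varepsilon_0^*\widehat G\otimes\gamma^*\widehat G\otimes(\bar\varepsilon_1^*\widehat G)^{\otimes-1}$ over $N\bar G(1)=G\times G$; both are well-defined smooth sections. Let $\delta\theta$ and $\bar\delta_\gamma\theta$ be the connections on these bundles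 induced by $\theta$, so that the pullbacks $\hat s^*(\delta\theta)\in\Omega^1(NG(2))$ and $\bar s_\gamma^*(\bar\delta_\gamma\theta)\in\Omega^1(N\bar G(1))$ are well-defined smooth forms. Then the cochain $$-c_1(\theta)-\left(\tfrac{-1}{2\pi i}\right)\bar s_\gamma^*(\bar\delta_\gamma\theta)\in\Omega^2(N\bar G),\qquad c_1(\theta)\in\Omega^2(N\bar G(0)),\quad \bar s_\gamma^*(\bar\delta_\gamma\theta)\in\Omega^1(N\bar G(1)),$$ is a Chern–Simons form of the simplicial Dixmier–Douady cocycle $c_1(\theta)-\left(\frac{-1}{2\pi i}\right)\hat s^*(\delta\theta)\in\Omega^3(NG)$, $c_1(\theta)\in\Omega^2(NG(1))$, $\hat s^*(\delta\theta)\in\Omega^1(NG(2))$: $$D\Bigl(-c_1(\theta)-\left(\tfrac{-1}{2\pi i}\right)\bar s_\gamma^*(\bar\delta_\gamma\theta)\Bigr)=\gamma^*\Bigl(c_1(\theta)-\left(\tfrac{-1}{2\pi i}\right)\hat s^*(\delta\theta)\Bigr).$$ -/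

import Mathlib

open scoped Manifold ContDiff

noncomputable section

/-! ### Differential forms on manifolds -/

section Forms

variable {E : Type*} [NormedAddCommGroup E] [NormedSpace ℝ E]
  {H : Type*} [TopologicalSpace H]
  {E' : Type*} [NormedAddCommGroup E'] [NormedSpace ℝ E']
  {H' : Type*} [TopologicalSpace H']

/-- Fields of complex valued alternating `n`-forms on the tangent spaces of `M`. The elements of
`Ωⁿ(M)` are those which moreover satisfy `DiffForm.IsSmooth`. -/
abbrev DiffForm (I : ModelWithCorners ℝ E H) (M : Type*) [TopologicalSpace M] [ChartedSpace H M]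
    (n : ℕ) : Type _ :=
  (x : M) → (TangentSpace I x) [⋀^Fin n]→L[ℝ] ℂ

namespace DiffForm

variable {I : ModelWithCorners ℝ E H} {I' : ModelWithCorners ℝ E' H'}
  {M : Type*} [TopologicalSpace M] [ChartedSpace H M]
  {M' : Type*} [TopologicalSpace M'] [ChartedSpace H' M'] {n : ℕ}

/-- The pullback `f^* α` of a form along a (differentiable) map. -/
def pullback (f : M → M') (α : DiffForm I' M' n) : DiffForm I M n := fun x =>
  (α (f x)).compContinuousLinearMap (mfderiv I I' f x)

/-- The expression of `α` in the preferred chart at `x₀`: the pullback of `α` by the inverse of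
that chart, a form on the model vector space. -/
def inChart (α : DiffForm I M n) (x₀ : M) : E → E [⋀^Fin n]→L[ℝ] ℂ := fun y =>
  (α ((extChartAt I x₀).symm y)).compContinuousLinearMap
    (mfderivWithin 𝓘(ℝ, E) I (extChartAt I x₀).symm (Set.range I) y)

/-- A form is smooth if its expressions in charts are smooth. -/
def IsSmooth (α : DiffForm I M n) : Prop :=
  ∀ x₀ : M, ContDiffOn ℝ ∞ (α.inChart x₀) (extChartAt I x₀).target

/-- The exterior derivative: at `x`, take the exterior derivative of the expression of `α` in the
chart at `x` and pull it back by that chart. -/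
def d (α : DiffForm I M n) : DiffForm I M (n + 1) := fun x =>
  ContinuousAlternatingMap.compContinuousLinearMap
    (extDerivWithin (α.inChart x) (Set.range I) (extChartAt I x x))
    (mfderiv I 𝓘(ℝ, E) (extChartAt I x) x)

end DiffForm

end Forms

/-! ### The total complex of the double complex `Ω^q(X_p)` -/

section DoubleComplex

variable {E : ℕ → Type*} [∀ p, NormedAddCommGroup (E p)] [∀ p, NormedSpace ℝ (E p)]
  {H : ℕ → Type*} [∀ p, TopologicalSpace (H p)]
  {E' : ℕ → Type*} [∀ p, NormedAddCommGroup (E' p)] [∀ p, NormedSpace ℝ (E' p)]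
  {H' : ℕ → Type*} [∀ p, TopologicalSpace (H' p)]

/-- Families `(α^{p,q})` of `q`-forms on the manifolds `X_p`. -/
abbrev Cochain (I : ∀ p, ModelWithCorners ℝ (E p) (H p)) (X : ℕ → Type*)
    [∀ p, TopologicalSpace (X p)] [∀ p, ChartedSpace (H p) (X p)] : Type _ :=
  (p q : ℕ) → DiffForm (I p) (X p) q

namespace Cochain

variable {I : ∀ p, ModelWithCorners ℝ (E p) (H p)} {X : ℕ → Type*}
  [∀ p, TopologicalSpace (X p)] [∀ p, ChartedSpace (H p) (X p)]
  {I' : ∀ p, ModelWithCorners ℝ (E' p) (H' p)} {X' : ℕ → Type*}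
  [∀ p, TopologicalSpace (X' p)] [∀ p, ChartedSpace (H' p) (X' p)]

/-- `α` lies in the degree `n` part `⨁_{p+q=n} Ω^q(X_p)` of the total complex. -/
def IsTotal (n : ℕ) (α : Cochain I X) : Prop :=
  (∀ p q, (α p q).IsSmooth) ∧ ∀ p q, p + q ≠ n → α p q = 0

/-- The part `Ω^q(X_p) → Ω^q(X_{p+1})` of the total differential: `d' = ∑ᵢ (-1)ⁱ εᵢ^*`. -/
def dHor (face : ∀ p, Fin (p + 2) → X (p + 1) → X p) {p q : ℕ} (α : DiffForm (I p) (X p) q) :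
    DiffForm (I (p + 1)) (X (p + 1)) q :=
  ∑ i : Fin (p + 2), (-1 : ℂ) ^ (i : ℕ) • DiffForm.pullback (face p i) α

/-- The part `Ω^q(X_p) → Ω^{q+1}(X_p)` of the total differential: `d'' = (-1)ᵖ d`. -/
def dVert {p q : ℕ} (α : DiffForm (I p) (X p) q) : DiffForm (I p) (X p) (q + 1) :=
  (-1 : ℂ) ^ p • α.d

/-- The total differential `D = d' + d''`, for the simplicial manifold `X` with face maps `face`. -/
def D (face : ∀ p, Fin (p + 2) → X (p + 1) → X p) (α : Cochain I X) : Cochain I X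
  | 0, 0 => 0
  | p + 1, 0 => dHor face (α p 0)
  | 0, q + 1 => dVert (α 0 q)
  | p + 1, q + 1 => dHor face (α p (q + 1)) + dVert (α (p + 1) q)

/-- Pullback of a cochain by a map of simplicial manifolds. -/
def pullback (f : ∀ p, X p → X' p) (α : Cochain I' X') : Cochain I X := fun p q =>
  (α p q).pullback (f p)

end Cochain

end DoubleComplex

/-! ### The simplicial manifolds `NG`, `N̄G` and the map `γ` -/

section Nerve

variable {G : Type*} [Group G]

/-- The face map `εᵢ : NG(p+1) → NG(p)`, where `NG(p) = Gᵖ`: `ε₀` forgets the first entry, `εᵢ`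
for `1 ≤ i ≤ p` multiplies the `i`-th entry by the next one, `ε_{p+1}` forgets the last entry. -/
def nerveFace (p : ℕ) (i : Fin (p + 2)) (g : Fin (p + 1) → G) : Fin p → G :=
  Fin.cases (Fin.tail g) (fun j => Fin.contractNth j (· * ·) g) i

/-- The face map `ε̄ᵢ : N̄G(p+1) → N̄G(p)`, where `N̄G(p) = G^{p+1}`: forget an entry. -/
def nerveBarFace (p : ℕ) (i : Fin (p + 2)) (h : Fin (p + 1 + 1) → G) : Fin (p + 1) → G :=
  fun k => h (i.succAbove k)

/-- `γ(h₁, …, h_{p+1}) = (h₁ h₂⁻¹, …, h_p h_{p+1}⁻¹)`. -/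
def nerveGamma (p : ℕ) (h : Fin (p + 1) → G) : Fin p → G :=
  fun k => h k.castSucc * (h k.succ)⁻¹

end Nerve

/-! ### Central extensions by `U(1)` and connections -/

section Extension

variable {E : Type*} [NormedAddCommGroup E] [NormedSpace ℝ E]
  {H : Type*} [TopologicalSpace H]
  {E' : Type*} [NormedAddCommGroup E'] [NormedSpace ℝ E']
  {H' : Type*} [TopologicalSpace H']

/-- A central extension of Lie groups `1 → U(1) → Ĝ → G → 1` which is a locally trivial principal
`U(1)`-bundle over `G`. -/
structure CentralExtension (I : ModelWithCorners ℝ E H) (I' : ModelWithCorners ℝ E' H')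
    (G : Type*) [TopologicalSpace G] [ChartedSpace H G] [Group G]
    (Ghat : Type*) [TopologicalSpace Ghat] [ChartedSpace H' Ghat] [Group Ghat] where
  /-- the projection -/
  ρ : Ghat →* G
  /-- the inclusion of the centre circle -/
  ι : Circle →* Ghat
  contMDiff_ρ : ContMDiff I' I ∞ ρ
  contMDiff_ι : ContMDiff (𝓡 1) I' ∞ ι
  ρ_surjective : Function.Surjective ρ
  ι_injective : Function.Injective ι
  range_ι : ι.range = ρ.ker
  central : ∀ (u : Circle) (a : Ghat), ι u * a = a * ι u
  /-- over a neighbourhood `U` of any point there are a smooth section `η` and a smooth fibre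
  coordinate `u`, such that `a ↦ (ρ a, u a)` and `(x, z) ↦ η x * ι z` are inverse to each other -/
  locally_trivial : ∀ g : G, ∃ U : Set G, IsOpen U ∧ g ∈ U ∧ ∃ (η : G → Ghat) (u : Ghat → Circle),
    ContMDiffOn I I' ∞ η U ∧ ContMDiffOn I' (𝓡 1) ∞ u (ρ ⁻¹' U) ∧
    (∀ x ∈ U, ρ (η x) = x) ∧ ∀ a ∈ ρ ⁻¹' U, a = η (ρ a) * ι (u a)

namespace CentralExtension

variable {I : ModelWithCorners ℝ E H} {I' : ModelWithCorners ℝ E' H'}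
  {G : Type*} [TopologicalSpace G] [ChartedSpace H G] [Group G]
  {Ghat : Type*} [TopologicalSpace Ghat] [ChartedSpace H' Ghat] [Group Ghat]
  (X : CentralExtension I I' G Ghat)

/-- A connection form on the principal `U(1)`-bundle `Ĝ → G`, with values in `Lie U(1) = iℝ`. -/
structure IsConnection (θ : DiffForm I' Ghat 1) : Prop where
  smooth : θ.IsSmooth
  imaginary : ∀ a v, (θ a v).re = 0
  invariant : ∀ u : Circle, θ.pullback (fun a => a * X.ι u) = θ
  /-- the fundamental vector field of `i ∈ iℝ` is sent to `i` -/
  vertical : ∀ a : Ghat,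
    θ.pullback (I := 𝓘(ℝ, ℝ)) (fun t : ℝ => a * X.ι (Circle.exp t)) 0 (fun _ => (1 : ℝ)) = Complex.I

/-- `c` is the smooth `2`-form `c₁(θ)` on `G`, that is `ρ^* c = (-1/2πi) dθ`. -/
def IsChernForm (θ : DiffForm I' Ghat 1) (c : DiffForm I G 2) : Prop :=
  c.IsSmooth ∧ c.pullback X.ρ = (-1 / (2 * (Real.pi : ℂ) * Complex.I)) • θ.d

/-! #### Tensor products of pulled back bundles

For maps `f₀, …, f_{k-1} : M → G` and signs `eⱼ = ±1`, we consider the `U(1)`-bundle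
`⨂ⱼ (fⱼ^* Ĝ)^{⊗ eⱼ}` over `M`, where the inverse of a `U(1)`-bundle is the same space with the
inverse action. -/

section Tensor

variable {M : Type*} {k : ℕ} (e : Fin k → ℤˣ) (f : Fin k → M → G)

/-- The fibre at `x` of the fibre product of the bundles `fⱼ^* Ĝ`. -/
abbrev ProdFiber (x : M) : Type _ := {a : Fin k → Ghat // ∀ j, X.ρ (a j) = f j x}

/-- Two points of the fibre product define the same point of the tensor product if they differ by
`(u₀, …, u_{k-1}) ∈ U(1)ᵏ` with `∏ⱼ uⱼ^{eⱼ} = 1`. -/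
def tensorSetoid (x : M) : Setoid (X.ProdFiber f x) where
  r a b := ∃ u : Fin k → Circle, ∏ j, u j ^ (e j : ℤ) = 1 ∧ ∀ j, b.1 j = a.1 j * X.ι (u j)
  iseqv :=
    { refl := fun a => ⟨1, by simp, by simp⟩
      symm := by
        rintro a b ⟨u, hu, h⟩
        exact ⟨u⁻¹, by simp [hu], fun j => by simp [h j]⟩
      trans := by
        rintro a b c ⟨u, hu, h⟩ ⟨v, hv, h'⟩
        exact ⟨u * v, by simp [mul_zpow, Finset.prod_mul_distrib, hu, hv],
          fun j => by simp [h j, h' j, mul_assoc]⟩ }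

/-- The fibre at `x` of the `U(1)`-bundle `⨂ⱼ (fⱼ^* Ĝ)^{⊗ eⱼ}`. -/
abbrev TensorFiber (x : M) : Type _ := Quotient (X.tensorSetoid e f x)

variable {e f}

/-- The point `⨂ⱼ aⱼ^{⊗ eⱼ}` of the tensor product. -/
def tmk {x : M} (a : X.ProdFiber f x) : X.TensorFiber e f x := Quotient.mk _ a

variable {EM : Type*} [NormedAddCommGroup EM] [NormedSpace ℝ EM] {HM : Type*} [TopologicalSpace HM]
  (J : ModelWithCorners ℝ EM HM) [TopologicalSpace M] [ChartedSpace HM M]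

/-- On the open set `U`, the section `s` of the tensor product is `⨂ⱼ aⱼ^{⊗ eⱼ}` for smooth
sections `aⱼ` of `fⱼ^* Ĝ`. -/
structure IsSmoothLift (s : ∀ x, X.TensorFiber e f x) (U : Set M) (a : Fin k → M → Ghat) :
    Prop where
  isOpen : IsOpen U
  smooth : ∀ j, ContMDiffOn J I' ∞ (a j) U
  eq_tmk : ∀ x ∈ U, ∃ h : ∀ j, X.ρ (a j x) = f j x, s x = X.tmk ⟨fun j => a j x, h⟩

/-- Smooth sections of the tensor product. -/
def IsSmoothSection (s : ∀ x, X.TensorFiber e f x) : Prop :=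
  ∀ x, ∃ U a, x ∈ U ∧ X.IsSmoothLift J s U a

/-- `σ` is the pullback `s^* Θ` by the smooth section `s` of the connection `Θ` induced by `θ` on
`⨂ⱼ (fⱼ^* Ĝ)^{⊗ eⱼ}`. As `Θ` is the form whose pullback to the fibre product of the `fⱼ^* Ĝ` is
the sum of the `eⱼ θ` on the factors, `s^* Θ = ∑ⱼ eⱼ aⱼ^* θ` whenever `s = ⨂ⱼ aⱼ^{⊗ eⱼ}`. -/
structure IsConnectionPullback (θ : DiffForm I' Ghat 1) (s : ∀ x, X.TensorFiber e f x)
    (σ : DiffForm J M 1) : Prop where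
  smooth_section : X.IsSmoothSection J s
  smooth : σ.IsSmooth
  eq_sum : ∀ U a, X.IsSmoothLift J s U a →
    ∀ x ∈ U, σ x = ∑ j, ((e j : ℤ) : ℂ) • θ.pullback (a j) x

end Tensor

/-! #### The bundles `δĜ` and `δ̄_γ Ĝ` with their trivial sections -/

/-- A lift of `g` to `Ĝ`. -/
def lift (g : G) : Ghat := Function.surjInv X.ρ_surjective g

/-- The signs of `δĜ = ε₀^* Ĝ ⊗ (ε₁^* Ĝ)^{⊗ -1} ⊗ ε₂^* Ĝ`. -/
def deltaSign : Fin 3 → ℤˣ := ![1, -1, 1]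

/-- The maps `ε₀, ε₁, ε₂ : NG(2) → NG(1) = G`. -/
def deltaMap (j : Fin 3) (g : Fin 2 → G) : G := nerveFace 1 j g 0

/-- The trivial section `ŝ = 1` of `δĜ`, in the trivialization given by
`ε₀^* Ĝ ⊗ ε₂^* Ĝ ≅ ε₁^* Ĝ`, `ĝ₂ ⊗ ĝ₁ ↦ ĝ₁ ĝ₂`:
it is `ĝ₂ ⊗ (ĝ₁ ĝ₂)^{⊗ -1} ⊗ ĝ₁` for any lifts `ĝ₁, ĝ₂` of `g₁, g₂`. -/
def deltaSection (g : Fin 2 → G) : X.TensorFiber deltaSign deltaMap g :=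
  X.tmk ⟨![X.lift (g 1), X.lift (g 0) * X.lift (g 1), X.lift (g 0)], by
    have h : ∀ x : G, X.ρ (X.lift x) = x := Function.surjInv_eq X.ρ_surjective
    intro j
    fin_cases j
    · exact h _
    · exact (map_mul X.ρ _ _).trans (congrArg₂ _ (h _) (h _))
    · exact h _⟩

/-- The signs of `δ̄_γ Ĝ = ε̄₀^* Ĝ ⊗ γ^* Ĝ ⊗ (ε̄₁^* Ĝ)^{⊗ -1}`. -/
def deltaBarSign : Fin 3 → ℤˣ := ![1, 1, -1]

/-- The maps `ε̄₀, γ, ε̄₁ : N̄G(1) → G`. -/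
def deltaBarMap : Fin 3 → (Fin (1 + 1) → G) → G :=
  ![fun h => nerveBarFace 0 0 h 0, fun h => nerveGamma 1 h 0, fun h => nerveBarFace 0 1 h 0]

/-- The trivial section `s̄_γ = 1` of `δ̄_γ Ĝ`, in the trivialization given by
`ε̄₀^* Ĝ ⊗ γ^* Ĝ ≅ ε̄₁^* Ĝ`, `ĥ₂ ⊗ ĝ ↦ ĝ ĥ₂`:
it is `ĥ₂ ⊗ ĝ ⊗ (ĝ ĥ₂)^{⊗ -1}` for any lifts `ĥ₂, ĝ` of `h₂, h₁ h₂⁻¹`. -/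
def deltaBarSection (h : Fin (1 + 1) → G) : X.TensorFiber deltaBarSign deltaBarMap h :=
  X.tmk ⟨![X.lift (h 1), X.lift (h 0 * (h 1)⁻¹), X.lift (h 0 * (h 1)⁻¹) * X.lift (h 1)], by
    have hl : ∀ x : G, X.ρ (X.lift x) = x := Function.surjInv_eq X.ρ_surjective
    intro j
    fin_cases j
    · exact hl _
    · exact hl _
    · exact (map_mul X.ρ _ _).trans
        ((congrArg₂ _ (hl _) (hl _)).trans (inv_mul_cancel_right (h 0) (h 1)))⟩

end CentralExtension

/-! ### The cochains -/

variable {I : ModelWithCorners ℝ E H} {G : Type*} [TopologicalSpace G] [ChartedSpace H G]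

/-- Cochains on `NG`. -/
abbrev NerveCochain (I : ModelWithCorners ℝ E H) (G : Type*) [TopologicalSpace G]
    [ChartedSpace H G] : Type _ :=
  Cochain (fun p => ModelWithCorners.pi fun _ : Fin p => I) (fun p => Fin p → G)

/-- Cochains on `N̄G`. -/
abbrev NerveBarCochain (I : ModelWithCorners ℝ E H) (G : Type*) [TopologicalSpace G]
    [ChartedSpace H G] : Type _ :=
  Cochain (fun p => ModelWithCorners.pi fun _ : Fin (p + 1) => I) (fun p => Fin (p + 1) → G)

/-- The simplicial Dixmier-Douady cochain `c - (-1/2πi) σ`, with `c ∈ Ω²(NG(1))` and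
`σ ∈ Ω¹(NG(2))`; the form `c` on `G` is transported by the identification `NG(1) = G`. -/
def dixmierDouadyCochain (c : DiffForm I G 2)
    (σ : DiffForm (ModelWithCorners.pi fun _ : Fin 2 => I) (Fin 2 → G) 1) : NerveCochain I G
  | 1, 2 => c.pullback (fun g => g 0)
  | 2, 1 => -((-1 / (2 * (Real.pi : ℂ) * Complex.I)) • σ)
  | _, _ => 0

/-- The Chern-Simons cochain `-c - (-1/2πi) σ`, with `c ∈ Ω²(N̄G(0))` and `σ ∈ Ω¹(N̄G(1))`; the
form `c` on `G` is transported by the identification `N̄G(0) = G`. -/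
def chernSimonsCochain (c : DiffForm I G 2)
    (σ : DiffForm (ModelWithCorners.pi fun _ : Fin (1 + 1) => I) (Fin (1 + 1) → G) 1) :
    NerveBarCochain I G
  | 0, 2 => -c.pullback (fun h => h 0)
  | 1, 1 => -((-1 / (2 * (Real.pi : ℂ) * Complex.I)) • σ)
  | _, _ => 0

end Extension

end

/-! Every form in the theorem is, locally, built from pullbacks of θ along smooth local lifts to
`Ghat`, so everything rests on how such a pullback depends on the lift. Two lifts of the same map
differ locally by a factor `ι (exp t)` with `t` a smooth real function (`exists_eq_mul_exp`: local
triviality plus a local logarithm on the circle). Invariance and verticality of θ then show that the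
pullback of θ changes by exactly i dt (`IsConnection.pullback_mul_exp`).

Well-definedness follows. Since i dt is closed, the pullback of dθ does not see the lift, so dθ
descends to a unique form on G; with the factor κ = -1/(2πi) this is c, and it is closed because
d(dθ) = 0. For a section of a tensor product of pulled back bundles, two lifts change Σ eⱼ aⱼ^*θ by
i d(Σ eⱼ tⱼ). The defining relation of the tensor product says exp(Σ eⱼ tⱼ) = 1, so this
differential vanishes (`IsConnection.sum_pullback_eq`). The two trivial sections do not depend on
the lifts because the circle is central.

Write σ and τ for the pullbacks of the induced connections by the sections over NG(2) and N̄G(1).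
The Chern-Simons cochain lives in bidegrees (0,2) and (1,1), so its differential has three
components. In (0,3) it vanishes by dc = 0. In (1,2), choose lifts p of h₁h₂⁻¹ and q of h₂; then pq
lifts h₁ and τ = q^*θ + p^*θ - (pq)^*θ, whence κ dτ = ε̄₀^*c + γ^*c - ε̄₁^*c. In (2,1), choose lifts
p, q, r of h₁h₂⁻¹, h₂h₃⁻¹, h₃. Abbreviating the pullback of θ by the name of the lift, the
alternating sum of the faces of τ is (r + q - qr) - (r + pq - pqr) + (qr + p - pqr) = q - pq + p,
which is γ^*σ. The cancellation of pqr is associativity in `Ghat`.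

The calculus before this transfers the standard facts on d and pullbacks from normed spaces to
manifolds through charts. -/

open scoped Topology

noncomputable section

/-! ### Alternating maps and the exterior derivative on normed spaces -/

section Linear

variable {𝕜 : Type*} [RCLike 𝕜] {E F V : Type*} [NormedAddCommGroup E] [NormedSpace 𝕜 E]
  [NormedAddCommGroup F] [NormedSpace 𝕜 F] [NormedAddCommGroup V] [NormedSpace 𝕜 V]

set_option synthInstance.maxHeartbeats 400000 in
set_option maxSynthPendingDepth 5 in
/-- The pullback of alternating maps along a linear map depends smoothly on the linear map. -/
theorem ContinuousAlternatingMap.contDiff_compContinuousLinearMapCLM {r : WithTop ℕ∞} (n : ℕ) :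
    ContDiff 𝕜 r (fun g : E →L[𝕜] F =>
      (compContinuousLinearMapCLM g : (F [⋀^Fin n]→L[𝕜] V) →L[𝕜] (E [⋀^Fin n]→L[𝕜] V))) := by
  induction n with
  | zero =>
    have h : (fun g : E →L[𝕜] F =>
        (compContinuousLinearMapCLM g : (F [⋀^Fin 0]→L[𝕜] V) →L[𝕜] (E [⋀^Fin 0]→L[𝕜] V))) =
        fun _ => compContinuousLinearMapCLM 0 := by
      funext g
      ext f v
      simp only [compContinuousLinearMapCLM_apply, compContinuousLinearMap_apply]
      congr 1
      exact Subsingleton.elim _ _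
    rw [h]
    exact contDiff_const
  | succ n ih =>
    -- Alternatizing the curried form of an alternating (n+1)-form multiplies it by n + 1. So the
    -- pullback in degree n + 1 is (n+1)⁻¹ times the alternatization of x ↦ g^*(f(g x, ·)), which
    -- involves g only linearly and through the pullback in degree n.
    have h : (fun g : E →L[𝕜] F =>
        (compContinuousLinearMapCLM g :
          (F [⋀^Fin (n + 1)]→L[𝕜] V) →L[𝕜] (E [⋀^Fin (n + 1)]→L[𝕜] V))) =
        fun g => ((n + 1 : 𝕜)⁻¹ • alternatizeUncurryFinCLM 𝕜 E V) ∘L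
          (ContinuousLinearMap.compL 𝕜 E (F [⋀^Fin n]→L[𝕜] V) (E [⋀^Fin n]→L[𝕜] V)
            (compContinuousLinearMapCLM g)) ∘L
          ((ContinuousLinearMap.compL 𝕜 E F (F [⋀^Fin n]→L[𝕜] V)).flip g) ∘L
          (curryLeftLI (𝕜 := 𝕜) (E := F) (F := V) (n := n)).toContinuousLinearMap := by
      funext g
      ext f v
      have hc : (compContinuousLinearMapCLM g :
          (F [⋀^Fin n]→L[𝕜] V) →L[𝕜] (E [⋀^Fin n]→L[𝕜] V)) ∘L f.curryLeft ∘L g =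
          (f.compContinuousLinearMap g).curryLeft := by
        ext x w
        simp
      have hn : (n + 1 : 𝕜) ≠ 0 := by exact_mod_cast n.succ_ne_zero
      change _ = (((n + 1 : 𝕜)⁻¹) • alternatizeUncurryFin
        ((compContinuousLinearMapCLM g :
          (F [⋀^Fin n]→L[𝕜] V) →L[𝕜] (E [⋀^Fin n]→L[𝕜] V)) ∘L f.curryLeft ∘L g)) v
      rw [hc, alternatizeUncurryFin_curryLeft]
      rw [← Nat.cast_smul_eq_nsmul 𝕜, smul_smul]
      push_cast
      rw [inv_mul_cancel₀ hn, one_smul]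
      rfl
    rw [h]
    have h₁ : ContDiff 𝕜 r (fun g : E →L[𝕜] F =>
        ContinuousLinearMap.compL 𝕜 E (F [⋀^Fin n]→L[𝕜] V) (E [⋀^Fin n]→L[𝕜] V)
          (compContinuousLinearMapCLM g)) := (ContinuousLinearMap.contDiff _).comp ih
    have h₂ : ContDiff 𝕜 r (fun g : E →L[𝕜] F =>
        (ContinuousLinearMap.compL 𝕜 E F (F [⋀^Fin n]→L[𝕜] V)).flip g) :=
      ContinuousLinearMap.contDiff _
    have h₃ := h₂.clm_comp (contDiff_const
      (c := (curryLeftLI (𝕜 := 𝕜) (E := F) (F := V) (n := n)).toContinuousLinearMap))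
    exact (contDiff_const (c := (n + 1 : 𝕜)⁻¹ • alternatizeUncurryFinCLM 𝕜 E V)).clm_comp
      (h₁.clm_comp h₃)

theorem ContDiffAt.continuousAlternatingMap_compContinuousLinearMap {W : Type*}
    [NormedAddCommGroup W] [NormedSpace 𝕜 W] {r : WithTop ℕ∞} {n : ℕ}
    {f : W → F [⋀^Fin n]→L[𝕜] V} {g : W → E →L[𝕜] F} {x : W}
    (hf : ContDiffAt 𝕜 r f x) (hg : ContDiffAt 𝕜 r g x) :
    ContDiffAt 𝕜 r (fun y => (f y).compContinuousLinearMap (g y)) x :=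
  ((ContinuousAlternatingMap.contDiff_compContinuousLinearMapCLM (V := V) n).contDiffAt.comp x hg).clm_apply
    hf

end Linear

section Calculus

variable {E : Type*} [NormedAddCommGroup E] [NormedSpace ℝ E]

theorem ContDiffAt.extDeriv_infty {n : ℕ} {V : Type*} [NormedAddCommGroup V] [NormedSpace ℝ V]
    {α : E → E [⋀^Fin n]→L[ℝ] V} {x : E}
    (h : ContDiffAt ℝ ∞ α x) : ContDiffAt ℝ ∞ (extDeriv α) x := by
  have h' : extDeriv α = fun y =>
      ContinuousAlternatingMap.alternatizeUncurryFinCLM ℝ E V (fderiv ℝ α y) := by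
    funext y
    rw [extDeriv, ContinuousAlternatingMap.alternatizeUncurryFinCLM_apply]
  rw [h']
  exact (ContinuousLinearMap.contDiff _).contDiffAt.comp x (h.fderiv_right (m := ∞) (by simp))

theorem extDeriv_const {n : ℕ} {V : Type*} [NormedAddCommGroup V] [NormedSpace ℝ V]
    (c : E [⋀^Fin n]→L[ℝ] V) (x : E) : extDeriv (fun _ => c) x = 0 := by
  rw [extDeriv, fderiv_fun_const, ← ContinuousAlternatingMap.alternatizeUncurryFinCLM_apply]
  exact map_zero _

theorem extDeriv_complex_smul {n : ℕ} (c : ℂ) (α : E → E [⋀^Fin n]→L[ℝ] ℂ) {x : E}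
    (h : DifferentiableAt ℝ α x) :
    extDeriv (fun y => c • α y) x = c • extDeriv α x := by
  rw [extDeriv, extDeriv, fderiv_fun_const_smul h,
    ContinuousAlternatingMap.alternatizeUncurryFin_smul]

end Calculus

/-! ### Differential forms on manifolds: pullbacks, smoothness, chart expressions -/

namespace DiffForm

variable {E : Type*} [NormedAddCommGroup E] [NormedSpace ℝ E]
  {H : Type*} [TopologicalSpace H]
  {E' : Type*} [NormedAddCommGroup E'] [NormedSpace ℝ E']
  {H' : Type*} [TopologicalSpace H']
  {E'' : Type*} [NormedAddCommGroup E''] [NormedSpace ℝ E'']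
  {H'' : Type*} [TopologicalSpace H'']
  {I : ModelWithCorners ℝ E H} {I' : ModelWithCorners ℝ E' H'} {I'' : ModelWithCorners ℝ E'' H''}
  {M : Type*} [TopologicalSpace M] [ChartedSpace H M]
  {M' : Type*} [TopologicalSpace M'] [ChartedSpace H' M']
  {M'' : Type*} [TopologicalSpace M''] [ChartedSpace H'' M''] {n : ℕ}

/-! ### Pullbacks -/

/-- The tangent spaces at x and y are different types that both unfold to the model space. Testing
on vectors of the model space allows the base point to change without transport. -/
theorem apply_congr (α : DiffForm I M n) {x y : M} (h : x = y) {v w : Fin n → E}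
    (hv : ∀ i, v i = w i) : (α x : E [⋀^Fin n]→L[ℝ] ℂ) v = (α y : E [⋀^Fin n]→L[ℝ] ℂ) w := by
  subst h
  rw [funext hv]

theorem pullback_apply (f : M → M') (α : DiffForm I' M' n) (x : M) (v : Fin n → E) :
    (pullback (I := I) f α x : E [⋀^Fin n]→L[ℝ] ℂ) v =
      (α (f x) : E' [⋀^Fin n]→L[ℝ] ℂ) (fun i => (mfderiv I I' f x : E →L[ℝ] E') (v i)) := rfl

theorem pullback_id (α : DiffForm I M n) : pullback (fun x => x) α = α := by
  funext x
  refine ContinuousAlternatingMap.ext fun v => ?_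
  refine apply_congr α rfl fun i => ?_
  exact congrArg (fun L : E →L[ℝ] E => L (v i)) (mfderiv_id (I := I) (x := x))

theorem pullback_comp {g : M' → M''} {f : M → M'} {x : M} (α : DiffForm I'' M'' n)
    (hg : MDifferentiableAt I' I'' g (f x)) (hf : MDifferentiableAt I I' f x) :
    pullback (I := I) (fun y => g (f y)) α x = pullback f (pullback (I := I') g α) x := by
  refine ContinuousAlternatingMap.ext fun v => ?_
  refine apply_congr α rfl fun i => ?_
  exact congrArg (fun L : E →L[ℝ] E'' => L (v i)) (mfderiv_comp x hg hf)

theorem pullback_congr {f g : M → M'} {x : M} (α : DiffForm I' M' n) (h : f =ᶠ[𝓝 x] g) :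
    pullback (I := I) f α x = pullback g α x := by
  refine ContinuousAlternatingMap.ext fun v => ?_
  refine apply_congr α h.eq_of_nhds fun i => ?_
  exact congrArg (fun L : E →L[ℝ] E' => L (v i)) h.mfderiv_eq

theorem pullback_congr_form {f : M → M'} {x : M} {α β : DiffForm I' M' n} (h : α (f x) = β (f x)) :
    pullback (I := I) f α x = pullback f β x := by
  simp only [pullback, h]

theorem pullback_zero (f : M → M') : pullback (I := I) f (0 : DiffForm I' M' n) = 0 := rfl

theorem pullback_add (f : M → M') (α β : DiffForm I' M' n) :
    pullback (I := I) f (α + β) = pullback f α + pullback f β := rfl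

theorem pullback_neg (f : M → M') (α : DiffForm I' M' n) :
    pullback (I := I) f (-α) = -pullback f α := rfl

theorem pullback_smul (f : M → M') (c : ℂ) (α : DiffForm I' M' n) :
    pullback (I := I) f (c • α) = c • pullback f α := rfl

theorem pullback_sum {ι : Type*} (s : Finset ι) (f : M → M') (α : ι → DiffForm I' M' n) :
    pullback (I := I) f (∑ i ∈ s, α i) = ∑ i ∈ s, pullback f (α i) := by
  classical
  induction s using Finset.induction_on with
  | empty => rfl
  | insert i s hi ih => rw [Finset.sum_insert hi, Finset.sum_insert hi, pullback_add, ih]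

/-! ### Smoothness at a point -/

/-- A form is smooth at `x` if its expression in the preferred chart at `x` is. -/
def SmoothAt (α : DiffForm I M n) (x : M) : Prop :=
  ContDiffAt ℝ ∞ (α.inChart x) (extChartAt I x x)

theorem smoothAt_zero (x : M) : (0 : DiffForm I M n).SmoothAt x :=
  contDiffAt_const (c := 0)

theorem SmoothAt.add {α β : DiffForm I M n} {x : M} (hα : α.SmoothAt x) (hβ : β.SmoothAt x) :
    (α + β).SmoothAt x :=
  ContDiffAt.add hα hβ

theorem SmoothAt.smul {α : DiffForm I M n} {x : M} (c : ℂ) (hα : α.SmoothAt x) :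
    (c • α).SmoothAt x :=
  ContDiffAt.const_smul c hα

theorem SmoothAt.neg {α : DiffForm I M n} {x : M} (hα : α.SmoothAt x) :
    (-α).SmoothAt x :=
  ContDiffAt.neg hα

theorem SmoothAt.sum {ι : Type*} (s : Finset ι) {α : ι → DiffForm I M n} {x : M}
    (h : ∀ i ∈ s, (α i).SmoothAt x) : (∑ i ∈ s, α i).SmoothAt x := by
  classical
  induction s using Finset.induction_on with
  | empty => exact smoothAt_zero x
  | insert i s hi ih =>
    rw [Finset.sum_insert hi]
    exact (h i (Finset.mem_insert_self i s)).add
      (ih fun j hj => h j (Finset.mem_insert_of_mem hj))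

/-! ### Expressions in charts -/

theorem inChart_congr {α β : DiffForm I M n} {x₀ x : M} (h : ∀ᶠ z in 𝓝 x, α z = β z)
    (hx : x ∈ (extChartAt I x₀).source) :
    α.inChart x₀ =ᶠ[𝓝 (extChartAt I x₀ x)] β.inChart x₀ := by
  have hy := (extChartAt I x₀).map_source hx
  have hc : Filter.Tendsto (extChartAt I x₀).symm (𝓝 (extChartAt I x₀ x)) (𝓝 x) := by
    have := continuousAt_extChartAt_symm'' (I := I) hy
    rwa [ContinuousAt, (extChartAt I x₀).left_inv hx] at this
  filter_upwards [hc.eventually h] with y hy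
  simp only [inChart, hy]

theorem SmoothAt.congr {α β : DiffForm I M n} {x : M} (hα : α.SmoothAt x) (h : ∀ᶠ z in 𝓝 x, β z = α z) :
    β.SmoothAt x :=
  ContDiffAt.congr_of_eventuallyEq hα (inChart_congr h (mem_extChartAt_source x))

section Boundaryless

variable [I.Boundaryless]

theorem inChart_apply (α : DiffForm I M n) (x₀ : M) (y : E) (v : Fin n → E) :
    α.inChart x₀ y v = (α ((extChartAt I x₀).symm y) : E [⋀^Fin n]→L[ℝ] ℂ)
      (fun i => (mfderiv 𝓘(ℝ, E) I (extChartAt I x₀).symm y : E →L[ℝ] E) (v i)) := by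
  rw [← mfderivWithin_univ, ← I.range_eq_univ]
  rfl

variable [IsManifold I ∞ M] [IsManifold I' ∞ M']

theorem contDiffAt_chart_expression {f : M → M'} {x₀ x : M} {y₀ : M'} (hx : x ∈ (extChartAt I x₀).source)
    (hf : ContMDiffAt I I' ∞ f x) (hfx : f x ∈ (extChartAt I' y₀).source) :
    ContDiffAt ℝ ∞ (fun z => extChartAt I' y₀ (f ((extChartAt I x₀).symm z)))
      (extChartAt I x₀ x) := by
  rw [extChartAt_source] at hx hfx
  have := ((contMDiffAt_iff_of_mem_source hx hfx).1 hf).2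
  rwa [I.range_eq_univ, contDiffWithinAt_univ] at this

variable [I'.Boundaryless]

theorem mdifferentiableAt_extChartAt_symm {x₀ : M} {y : E} (hy : y ∈ (extChartAt I x₀).target) :
    MDifferentiableAt 𝓘(ℝ, E) I (extChartAt I x₀).symm y := by
  have := mdifferentiableWithinAt_extChartAt_symm (I := I) hy
  rwa [I.range_eq_univ, mdifferentiableWithinAt_univ] at this

theorem mfderiv_extChartAt_symm_mfderiv_extChartAt {x₀ x : M}
    (hx : x ∈ (extChartAt I x₀).source) (v : E) :
    (mfderiv 𝓘(ℝ, E) I (extChartAt I x₀).symm (extChartAt I x₀ x) : E →L[ℝ] E)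
      ((mfderiv I 𝓘(ℝ, E) (extChartAt I x₀) x : E →L[ℝ] E) v) = v := by
  have := mfderivWithin_extChartAt_symm_comp_mfderiv_extChartAt' (I := I) hx
  rw [I.range_eq_univ, mfderivWithin_univ] at this
  exact congrArg (fun L : E →L[ℝ] E => L v) this

theorem mfderiv_extChartAt_mfderiv_extChartAt_symm {x₀ : M} {y : E}
    (hy : y ∈ (extChartAt I x₀).target) (v : E) :
    (mfderiv I 𝓘(ℝ, E) (extChartAt I x₀) ((extChartAt I x₀).symm y) : E →L[ℝ] E)
      ((mfderiv 𝓘(ℝ, E) I (extChartAt I x₀).symm y : E →L[ℝ] E) v) = v := by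
  have := mfderiv_extChartAt_comp_mfderivWithin_extChartAt_symm (I := I) hy
  rw [I.range_eq_univ, mfderivWithin_univ] at this
  exact congrArg (fun L : E →L[ℝ] E => L v) this

/-- By the chain rule the derivative of the coordinate expression of f is the derivative of f
between those of the two chart maps; the derivative of the inverse chart at `y₀` then cancels that
of the chart. -/
theorem inChart_pullback_apply {f : M → M'} (α : DiffForm I' M' n) {x₀ : M} {y₀ : M'} {y : E}
    (hy : y ∈ (extChartAt I x₀).target)
    (hf : MDifferentiableAt I I' f ((extChartAt I x₀).symm y))
    (hfy : f ((extChartAt I x₀).symm y) ∈ (extChartAt I' y₀).source) :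
    (pullback (I := I) f α).inChart x₀ y =
      (α.inChart y₀ (extChartAt I' y₀ (f ((extChartAt I x₀).symm y)))).compContinuousLinearMap
        (fderiv ℝ (fun z => extChartAt I' y₀ (f ((extChartAt I x₀).symm z))) y) := by
  ext v
  rw [ContinuousAlternatingMap.compContinuousLinearMap_apply, inChart_apply α y₀,
    inChart_apply (pullback f α) x₀]
  refine apply_congr α ((extChartAt I' y₀).left_inv hfy).symm fun i => ?_
  have hs := mdifferentiableAt_extChartAt_symm (I := I) hy
  have h₁ : MDifferentiableAt I' 𝓘(ℝ, E') (extChartAt I' y₀) (f ((extChartAt I x₀).symm y)) :=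
    mdifferentiableAt_extChartAt (by rwa [extChartAt_source] at hfy)
  have hd : (fderiv ℝ (fun z => extChartAt I' y₀ (f ((extChartAt I x₀).symm z))) y) (v i) =
      (mfderiv I' 𝓘(ℝ, E') (extChartAt I' y₀) (f ((extChartAt I x₀).symm y)) : E' →L[ℝ] E')
        ((mfderiv I I' f ((extChartAt I x₀).symm y) : E →L[ℝ] E')
          ((mfderiv 𝓘(ℝ, E) I (extChartAt I x₀).symm y : E →L[ℝ] E) (v i))) := by
    rw [← mfderiv_eq_fderiv]
    have e₁ := mfderiv_comp (I := 𝓘(ℝ, E)) (I' := I) (I'' := 𝓘(ℝ, E')) y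
      (g := fun x => extChartAt I' y₀ (f x)) (h₁.comp _ hf) hs
    have e₂ := mfderiv_comp ((extChartAt I x₀).symm y) h₁ hf
    refine (congrArg (fun L : E →L[ℝ] E' => L (v i)) e₁).trans ?_
    exact congrArg (fun L : E →L[ℝ] E' =>
      L ((mfderiv 𝓘(ℝ, E) I (extChartAt I x₀).symm y : E →L[ℝ] E) (v i))) e₂
  simp only [Function.comp_apply]
  rw [hd]
  exact (mfderiv_extChartAt_symm_mfderiv_extChartAt hfy _).symm

theorem inChart_pullback {f : M → M'} (α : DiffForm I' M' n) {x₀ x : M} {y₀ : M'}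
    (hx : x ∈ (extChartAt I x₀).source) (hf : ContMDiffAt I I' 1 f x)
    (hfx : f x ∈ (extChartAt I' y₀).source) :
    (pullback (I := I) f α).inChart x₀ =ᶠ[𝓝 (extChartAt I x₀ x)] fun y =>
      (α.inChart y₀ (extChartAt I' y₀ (f ((extChartAt I x₀).symm y)))).compContinuousLinearMap
        (fderiv ℝ (fun z => extChartAt I' y₀ (f ((extChartAt I x₀).symm z))) y) := by
  have hy := (extChartAt I x₀).map_source hx
  have hc : Filter.Tendsto (extChartAt I x₀).symm (𝓝 (extChartAt I x₀ x)) (𝓝 x) := by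
    have := continuousAt_extChartAt_symm'' (I := I) hy
    rwa [ContinuousAt, (extChartAt I x₀).left_inv hx] at this
  have h₁ : ∀ᶠ z in 𝓝 x, MDifferentiableAt I I' f z :=
    ((contMDiffAt_iff_contMDiffAt_nhds (by simp)).1 hf).mono fun z hz => hz.mdifferentiableAt (by simp)
  have h₂ : ∀ᶠ z in 𝓝 x, f z ∈ (extChartAt I' y₀).source :=
    hf.continuousAt.preimage_mem_nhds ((isOpen_extChartAt_source y₀).mem_nhds hfx)
  filter_upwards [hc.eventually h₁, hc.eventually h₂,
    (isOpen_extChartAt_target x₀).mem_nhds hy] with y hy₁ hy₂ hy₃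
  exact inChart_pullback_apply α hy₃ hy₁ hy₂

theorem contDiffAt_inChart_pullback {f : M → M'}
    {α : DiffForm I' M' n} {x₀ x : M} {y₀ : M'}
    (hα : ContDiffAt ℝ ∞ (α.inChart y₀) (extChartAt I' y₀ (f x)))
    (hx : x ∈ (extChartAt I x₀).source) (hf : ContMDiffAt I I' ∞ f x)
    (hfx : f x ∈ (extChartAt I' y₀).source) :
    ContDiffAt ℝ ∞ ((pullback (I := I) f α).inChart x₀) (extChartAt I x₀ x) := by
  refine ContDiffAt.congr_of_eventuallyEq ?_
    (inChart_pullback α hx (hf.of_le (by simp)) hfx)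
  have hF := contDiffAt_chart_expression hx hf hfx
  refine ContDiffAt.continuousAlternatingMap_compContinuousLinearMap ?_
    (hF.fderiv_right (m := ∞) (by simp))
  refine ContDiffAt.comp (g := α.inChart y₀) (extChartAt I x₀ x) ?_ hF
  rwa [(extChartAt I x₀).left_inv hx]

/-- A change of charts is a pullback along the identity, read in different charts at source and
target. -/
theorem smoothAt_iff_of_mem_source {α : DiffForm I M n} {x₀ x : M}
    (hx : x ∈ (extChartAt I x₀).source) :
    α.SmoothAt x ↔ ContDiffAt ℝ ∞ (α.inChart x₀) (extChartAt I x₀ x) := by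
  constructor <;> intro h
  · have := contDiffAt_inChart_pullback (f := fun x => x) h hx contMDiffAt_id
      (mem_extChartAt_source x)
    rwa [pullback_id] at this
  · have := contDiffAt_inChart_pullback (f := fun x => x) h (mem_extChartAt_source x)
      contMDiffAt_id hx
    rwa [pullback_id] at this

theorem isSmooth_iff {α : DiffForm I M n} : α.IsSmooth ↔ ∀ x, α.SmoothAt x := by
  constructor
  · intro h x
    exact (h x).contDiffAt ((isOpen_extChartAt_target x).mem_nhds (mem_extChartAt_target x))
  · intro h x₀ y hy
    have hs := (extChartAt I x₀).map_target hy
    have := (smoothAt_iff_of_mem_source hs).1 (h _)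
    rw [(extChartAt I x₀).right_inv hy] at this
    exact this.contDiffWithinAt

theorem SmoothAt.pullback {f : M → M'} {α : DiffForm I' M' n} {x : M} (hα : α.SmoothAt (f x))
    (hf : ContMDiffAt I I' ∞ f x) : (pullback (I := I) f α).SmoothAt x :=
  contDiffAt_inChart_pullback hα (mem_extChartAt_source x) hf (mem_extChartAt_source (f x))

end Boundaryless

end DiffForm

namespace DiffForm

variable {E : Type*} [NormedAddCommGroup E] [NormedSpace ℝ E]
  {H : Type*} [TopologicalSpace H]
  {E' : Type*} [NormedAddCommGroup E'] [NormedSpace ℝ E']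
  {H' : Type*} [TopologicalSpace H']
  {I : ModelWithCorners ℝ E H} {I' : ModelWithCorners ℝ E' H'}
  {M : Type*} [TopologicalSpace M] [ChartedSpace H M]
  {M' : Type*} [TopologicalSpace M'] [ChartedSpace H' M'] {n : ℕ}

/-! ### The exterior derivative -/

theorem ext_apply {x : M} {a b : (TangentSpace I x) [⋀^Fin n]→L[ℝ] ℂ}
    (h : ∀ v : Fin n → E, (a : E [⋀^Fin n]→L[ℝ] ℂ) v = (b : E [⋀^Fin n]→L[ℝ] ℂ) v) : a = b :=
  ContinuousAlternatingMap.ext h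

theorem minSmoothness_two_le_infty : minSmoothness ℝ 2 ≤ (∞ : WithTop ℕ∞) := by
  rw [minSmoothness_of_isRCLikeNormedField]
  exact WithTop.coe_le_coe.2 le_top

section Boundaryless

variable [I.Boundaryless]

theorem d_apply (α : DiffForm I M n) (x : M) (v : Fin (n + 1) → E) :
    (α.d x : E [⋀^Fin (n + 1)]→L[ℝ] ℂ) v =
      extDeriv (α.inChart x) (extChartAt I x x)
        (fun i => (mfderiv I 𝓘(ℝ, E) (extChartAt I x) x : E →L[ℝ] E) (v i)) := by
  rw [← extDerivWithin_univ, ← I.range_eq_univ]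
  rfl

theorem d_congr {α β : DiffForm I M n} {x : M} (h : ∀ᶠ z in 𝓝 x, α z = β z) :
    α.d x = β.d x := by
  refine ext_apply fun v => ?_
  refine (d_apply α x v).trans (Eq.trans ?_ (d_apply β x v).symm)
  rw [(inChart_congr h (mem_extChartAt_source x)).extDeriv_eq]

theorem d_zero : (0 : DiffForm I M n).d = 0 := by
  funext x
  refine ext_apply fun v => ?_
  -- Writing zero as a multiple by the scalar 0 reduces the claim to homogeneity of `extDeriv`.
  have h : (0 : DiffForm I M n).inChart x = (0 : ℝ) • (0 : DiffForm I M n).inChart x := by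
    funext y
    exact (zero_smul ℝ (0 : E [⋀^Fin n]→L[ℝ] ℂ)).symm
  have h' : extDeriv ((0 : DiffForm I M n).inChart x) (extChartAt I x x) = 0 := by
    rw [h, extDeriv_smul, zero_smul]
  exact (d_apply 0 x v).trans (congrArg (fun L : E [⋀^Fin (n + 1)]→L[ℝ] ℂ => L _) h')

theorem SmoothAt.d_add {α β : DiffForm I M n} {x : M} (hα : α.SmoothAt x) (hβ : β.SmoothAt x) :
    (α + β).d x = α.d x + β.d x := by
  refine ext_apply fun v => ?_
  have h : extDeriv ((α + β).inChart x) (extChartAt I x x) =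
      extDeriv (α.inChart x) (extChartAt I x x) + extDeriv (β.inChart x) (extChartAt I x x) :=
    extDeriv_add (hα.differentiableAt (by simp)) (hβ.differentiableAt (by simp))
  exact ((d_apply _ x v).trans (congrArg (fun L : E [⋀^Fin (n + 1)]→L[ℝ] ℂ => L _) h)).trans
    (congrArg₂ (· + ·) (d_apply α x v).symm (d_apply β x v).symm)

theorem SmoothAt.d_smul {α : DiffForm I M n} {x : M} (c : ℂ) (hα : α.SmoothAt x) :
    (c • α).d x = c • α.d x := by
  refine ext_apply fun v => ?_
  have h : extDeriv ((c • α).inChart x) (extChartAt I x x) =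
      c • extDeriv (α.inChart x) (extChartAt I x x) :=
    extDeriv_complex_smul c _ (hα.differentiableAt (by simp))
  exact ((d_apply _ x v).trans (congrArg (fun L : E [⋀^Fin (n + 1)]→L[ℝ] ℂ => L _) h)).trans
    (congrArg (c • ·) (d_apply α x v).symm)

theorem SmoothAt.d_neg {α : DiffForm I M n} {x : M} (hα : α.SmoothAt x) :
    (-α).d x = -α.d x := by
  have h := hα.d_smul (-1)
  rwa [neg_one_smul ℂ α, neg_one_smul ℂ (α.d x : E [⋀^Fin (n + 1)]→L[ℝ] ℂ)] at h

theorem SmoothAt.d_sum {ι : Type*} (s : Finset ι) {α : ι → DiffForm I M n} {x : M}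
    (h : ∀ i ∈ s, (α i).SmoothAt x) : (∑ i ∈ s, α i).d x = ∑ i ∈ s, (α i).d x := by
  classical
  induction s using Finset.induction_on with
  | empty => simp [d_zero]
  | insert i s hi ih =>
    have h' : ∀ j ∈ s, (α j).SmoothAt x := fun j hj => h j (Finset.mem_insert_of_mem hj)
    rw [Finset.sum_insert hi, Finset.sum_insert hi,
      (h i (Finset.mem_insert_self i s)).d_add (SmoothAt.sum s h'), ih h']

variable [I'.Boundaryless] [IsManifold I ∞ M] [IsManifold I' ∞ M']

/-- Naturality of d on normed spaces, applied to the coordinate expression of f. The charts are left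
arbitrary on both sides: preferred charts give compatibility with pullbacks, and f = id gives
independence of the chart. -/
theorem extDeriv_inChart_pullback {f : M → M'} {α : DiffForm I' M' n} {x₀ x : M} {y₀ : M'}
    (hα : α.SmoothAt (f x)) (hx : x ∈ (extChartAt I x₀).source) (hf : ContMDiffAt I I' ∞ f x)
    (hfx : f x ∈ (extChartAt I' y₀).source) (v : Fin (n + 1) → E) :
    extDeriv ((pullback (I := I) f α).inChart x₀) (extChartAt I x₀ x)
        (fun i => (mfderiv I 𝓘(ℝ, E) (extChartAt I x₀) x : E →L[ℝ] E) (v i)) =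
      extDeriv (α.inChart y₀) (extChartAt I' y₀ (f x))
        (fun i => (mfderiv I' 𝓘(ℝ, E') (extChartAt I' y₀) (f x) : E' →L[ℝ] E')
          ((mfderiv I I' f x : E →L[ℝ] E') (v i))) := by
  have hF := contDiffAt_chart_expression hx hf hfx
  have hα' := (smoothAt_iff_of_mem_source hfx).1 hα
  have hl := (extChartAt I x₀).left_inv hx
  have hd : extDeriv ((pullback (I := I) f α).inChart x₀) (extChartAt I x₀ x) =
      (extDeriv (α.inChart y₀) (extChartAt I' y₀ (f x))).compContinuousLinearMap
        (fderiv ℝ (fun z => extChartAt I' y₀ (f ((extChartAt I x₀).symm z)))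
          (extChartAt I x₀ x)) := by
    rw [(inChart_pullback α hx (hf.of_le (by simp)) hfx).extDeriv_eq,
      extDeriv_pullback (f := fun z => extChartAt I' y₀ (f ((extChartAt I x₀).symm z)))
        (by simpa only [hl] using hα'.differentiableAt (by simp)) hF minSmoothness_two_le_infty, hl]
  refine (congrArg (fun L : E [⋀^Fin (n + 1)]→L[ℝ] ℂ => L _) hd).trans ?_
  refine congrArg (extDeriv (α.inChart y₀) (extChartAt I' y₀ (f x))) (funext fun i => ?_)
  have h₁ : MDifferentiableAt I' 𝓘(ℝ, E') (extChartAt I' y₀) (f x) :=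
    mdifferentiableAt_extChartAt (by rwa [extChartAt_source] at hfx)
  have h₂ : MDifferentiableAt I 𝓘(ℝ, E) (extChartAt I x₀) x :=
    mdifferentiableAt_extChartAt (by rwa [extChartAt_source] at hx)
  have e₁ := mfderiv_comp x h₁ (hf.mdifferentiableAt (by simp))
  have e₂ := mfderiv_comp (I'' := 𝓘(ℝ, E')) x
    (hF.differentiableAt (by simp)).mdifferentiableAt h₂
  have e₃ : (extChartAt I' y₀) ∘ f =ᶠ[𝓝 x]
      (fun z => extChartAt I' y₀ (f ((extChartAt I x₀).symm z))) ∘ extChartAt I x₀ := by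
    filter_upwards [(isOpen_extChartAt_source (I := I) x₀).mem_nhds hx] with z hz
    simp only [Function.comp_apply, (extChartAt I x₀).left_inv hz]
  have e₄ := (e₁.symm.trans e₃.mfderiv_eq).trans e₂
  rw [mfderiv_eq_fderiv] at e₄
  exact (congrArg (fun L : E →L[ℝ] E' => L (v i)) e₄).symm

/-- The exterior derivative commutes with pullbacks. -/
theorem SmoothAt.d_pullback {f : M → M'} {α : DiffForm I' M' n} {x : M} (hα : α.SmoothAt (f x))
    (hf : ContMDiffAt I I' ∞ f x) : (DiffForm.pullback (I := I) f α).d x = DiffForm.pullback f α.d x := by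
  refine ext_apply fun v => ?_
  refine (d_apply _ x v).trans (Eq.trans ?_ (d_apply α (f x) _).symm)
  exact extDeriv_inChart_pullback hα (mem_extChartAt_source x) hf (mem_extChartAt_source (f x)) v

/-- The exterior derivative can be computed in any chart. -/
theorem SmoothAt.d_eq {α : DiffForm I M n} {x₀ x : M} (hα : α.SmoothAt x)
    (hx : x ∈ (extChartAt I x₀).source) (v : Fin (n + 1) → E) :
    (α.d x : E [⋀^Fin (n + 1)]→L[ℝ] ℂ) v =
      extDeriv (α.inChart x₀) (extChartAt I x₀ x)
        (fun i => (mfderiv I 𝓘(ℝ, E) (extChartAt I x₀) x : E →L[ℝ] E) (v i)) := by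
  refine (d_apply α x v).trans ?_
  have h := extDeriv_inChart_pullback (f := fun x => x) hα hx contMDiffAt_id
    (mem_extChartAt_source x) v
  rw [pullback_id] at h
  rw [h]
  congr 1
  funext i
  exact congrArg (mfderiv I 𝓘(ℝ, E) (extChartAt I x) x : E →L[ℝ] E)
    (congrArg (fun L : E →L[ℝ] E => L (v i)) (mfderiv_id (I := I) (x := x))).symm

/-- The definition of `d` uses a different chart at each point. Chart independence puts all these
values in one chart, which is needed to differentiate `α.d` again. -/
theorem inChart_d {α : DiffForm I M n} (hα : ∀ x, α.SmoothAt x) (x₀ : M)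
    {y : E} (hy : y ∈ (extChartAt I x₀).target) :
    α.d.inChart x₀ y = extDeriv (α.inChart x₀) y := by
  ext v
  rw [inChart_apply α.d x₀]
  refine (SmoothAt.d_eq (hα _) ((extChartAt I x₀).map_target hy) _).trans ?_
  rw [(extChartAt I x₀).right_inv hy]
  congr 1
  funext i
  exact mfderiv_extChartAt_mfderiv_extChartAt_symm hy (v i)

theorem IsSmooth.d {α : DiffForm I M n} (hα : α.IsSmooth) : α.d.IsSmooth := by
  rw [isSmooth_iff] at hα ⊢
  intro x
  have hy := mem_extChartAt_target (I := I) x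
  refine (ContDiffAt.extDeriv_infty (hα x)).congr_of_eventuallyEq ?_
  filter_upwards [(isOpen_extChartAt_target x).mem_nhds hy] with y hy
  exact inChart_d hα x hy

theorem IsSmooth.d_d {α : DiffForm I M n} (hα : α.IsSmooth) : α.d.d = 0 := by
  rw [isSmooth_iff] at hα
  funext x
  refine ext_apply fun v => ?_
  have hy := mem_extChartAt_target (I := I) x
  have h : α.d.inChart x =ᶠ[𝓝 (extChartAt I x x)] extDeriv (α.inChart x) := by
    filter_upwards [(isOpen_extChartAt_target x).mem_nhds hy] with y hy
    exact inChart_d hα x hy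
  have h' := h.extDeriv_eq.trans (extDeriv_extDeriv_apply (hα x) minSmoothness_two_le_infty)
  exact (d_apply _ x v).trans (congrArg (fun L : E [⋀^Fin (n + 2)]→L[ℝ] ℂ => L _) h')

end Boundaryless

end DiffForm

section Pi

/-! ### Finite products of manifolds -/

variable {ι : Type*} [Fintype ι] {E : ι → Type*} [∀ i, NormedAddCommGroup (E i)]
  [∀ i, NormedSpace ℝ (E i)] {H : ι → Type*} [∀ i, TopologicalSpace (H i)]
  {I : ∀ i, ModelWithCorners ℝ (E i) (H i)}
  {M : ι → Type*} [∀ i, TopologicalSpace (M i)] [∀ i, ChartedSpace (H i) (M i)]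
  {F : Type*} [NormedAddCommGroup F] [NormedSpace ℝ F] {K : Type*} [TopologicalSpace K]
  {J : ModelWithCorners ℝ F K} {N : Type*} [TopologicalSpace N] [ChartedSpace K N]
  {r : WithTop ℕ∞}

instance ModelWithCorners.boundaryless_pi [∀ i, (I i).Boundaryless] :
    (ModelWithCorners.pi I).Boundaryless where
  range_eq_univ := by
    refine Set.eq_univ_of_forall fun y => ⟨fun i => (I i).symm (y i), ?_⟩
    funext i
    exact (I i).right_inv (by simp [(I i).range_eq_univ])

/-- The charts and the model of a product are taken componentwise, so this reduces to the same fact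
for maps into a product of normed spaces. -/
theorem contMDiffAt_pi_iff {f : N → ∀ i, M i} {x : N} :
    ContMDiffAt J (ModelWithCorners.pi I) r f x ↔ ∀ i, ContMDiffAt J (I i) r (fun y => f y i) x := by
  simp only [contMDiffAt_iff, forall_and, continuousAt_pi]
  refine and_congr_right fun _ => ?_
  exact contDiffWithinAt_pi

theorem contMDiff_pi_iff {f : N → ∀ i, M i} :
    ContMDiff J (ModelWithCorners.pi I) r f ↔ ∀ i, ContMDiff J (I i) r (fun y => f y i) :=
  ⟨fun h i x => contMDiffAt_pi_iff.1 (h x) i, fun h x => contMDiffAt_pi_iff.2 fun i => h i x⟩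

theorem contMDiff_pi_apply (i : ι) :
    ContMDiff (ModelWithCorners.pi I) (I i) r (fun x : ∀ i, M i => x i) :=
  contMDiff_pi_iff.1 contMDiff_id i

instance IsManifold.pi [∀ i, IsManifold (I i) r (M i)] :
    IsManifold (ModelWithCorners.pi I) r (∀ i, M i) := by
  refine isManifold_of_contDiffOn _ _ _ ?_
  rintro _ _ ⟨a, ha, rfl⟩ ⟨b, hb, rfl⟩
  refine contDiffOn_pi.2 fun i => ?_
  have h := ((contDiffGroupoid r (I i)).compatible (ha i trivial) (hb i trivial))
  rw [contDiffGroupoid, mem_groupoid_of_pregroupoid] at h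
  have h' := h.1
  refine ContDiffOn.comp (g := (I i) ∘ ((a i).symm ≫ₕ b i) ∘ (I i).symm) h'
    (contDiff_pi.1 contDiff_id i).contDiffOn ?_
  rintro y ⟨⟨h₁, h₂⟩, z, rfl⟩
  exact ⟨⟨h₁ i trivial, h₂ i trivial⟩, z i, rfl⟩

end Pi

/-! ### Local logarithms on the circle -/

section Circle

variable {F : Type*} [NormedAddCommGroup F] [NormedSpace ℝ F] {K : Type*} [TopologicalSpace K]
  {J : ModelWithCorners ℝ F K} {M : Type*} [TopologicalSpace M] [ChartedSpace K M]

theorem Circle.contMDiff_coe : ContMDiff (𝓡 1) 𝓘(ℝ, ℂ) ∞ (fun z : Circle => (z : ℂ)) :=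
  haveI := finrank_real_complex_fact'
  contMDiff_coe_sphere (E := ℂ) (n := 1)

/-- Smooth maps to the circle have smooth local logarithms. -/
theorem ContMDiffAt.exists_circleExp_eq {w : M → Circle} {x₀ : M}
    (hw : ContMDiffAt J (𝓡 1) ∞ w x₀) :
    ∃ t : M → ℝ, ContMDiffAt J 𝓘(ℝ, ℝ) ∞ t x₀ ∧ ∀ x, w x = Circle.exp (t x) := by
  -- Dividing by `w x₀` moves the value at `x₀` to 1, away from the branch cut of the argument. The
  -- identity w = exp t holds everywhere, smoothness of t only at `x₀`.
  refine ⟨fun x => Complex.arg ((w x : ℂ) * ((w x₀)⁻¹ : Circle)) + Complex.arg (w x₀), ?_, ?_⟩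
  · have hm : ContDiffAt ℝ ∞ (fun z : ℂ => Complex.arg (z * ((w x₀)⁻¹ : Circle)) +
        Complex.arg (w x₀)) (w x₀ : ℂ) := by
      have h₁ : ((w x₀ : ℂ) * ((w x₀)⁻¹ : Circle)) ∈ Complex.slitPlane := by
        rw [← Circle.coe_mul, mul_inv_cancel, Circle.coe_one]
        exact Complex.one_mem_slitPlane
      have h₂ : ContDiffAt ℝ ∞ Complex.log ((w x₀ : ℂ) * ((w x₀)⁻¹ : Circle)) :=
        (Complex.contDiffAt_log h₁).restrict_scalars ℝ
      have h₃ : ContDiffAt ℝ ∞ (fun z : ℂ => z * ((w x₀)⁻¹ : Circle)) (w x₀ : ℂ) :=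
        contDiffAt_id.mul contDiffAt_const
      have h₄ : ContDiffAt ℝ ∞ (fun z : ℂ => Complex.imCLM (Complex.log (z * ((w x₀)⁻¹ : Circle))))
          (w x₀ : ℂ) :=
        Complex.imCLM.contDiff.contDiffAt.comp (w x₀ : ℂ)
          (ContDiffAt.comp (g := Complex.log) (w x₀ : ℂ) h₂ h₃)
      refine ContDiffAt.add ?_ contDiffAt_const
      simpa only [Complex.imCLM_apply, Complex.log_im] using h₄
    exact ContMDiffAt.comp (I' := 𝓘(ℝ, ℂ)) (f := fun x => (w x : ℂ)) x₀ hm.contMDiffAt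
      ((Circle.contMDiff_coe _).comp x₀ hw)
  · intro x
    have h := Circle.exp_arg (w x * (w x₀)⁻¹)
    rw [Circle.coe_mul] at h
    rw [Circle.exp_add, Circle.exp_arg, h, inv_mul_cancel_right]

end Circle

/-! ### The form i dt on the line -/

namespace DiffForm

theorem oneForm_map_add {V : Type*} [NormedAddCommGroup V] [NormedSpace ℝ V]
    (L : V [⋀^Fin 1]→L[ℝ] ℂ) (v w : Fin 1 → V) : L (fun i => v i + w i) = L v + L w := by
  have h := L.map_update_add v 0 (v 0) (w 0)
  have e : ∀ y : V, Function.update v 0 y = fun _ => y := fun y => by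
    funext i
    rw [Subsingleton.elim i 0, Function.update_self]
  have e' : ∀ u : Fin 1 → V, u = fun _ => u 0 := fun u => by
    funext i
    rw [Subsingleton.elim i 0]
  rw [e, e, e] at h
  rw [e' (fun i => v i + w i), h, ← e', ← e']

theorem oneForm_map_smul (L : ℝ [⋀^Fin 1]→L[ℝ] ℂ) (c : ℝ) :
    L (fun _ => c • (1 : ℝ)) = c • L (fun _ => (1 : ℝ)) := by
  have h := L.toContinuousMultilinearMap.map_smul_univ (fun _ : Fin 1 => c) (fun _ => (1 : ℝ))
  rwa [Fin.prod_univ_one] at h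

/-- The form `i dt` on the real line. -/
def lineForm : DiffForm 𝓘(ℝ, ℝ) ℝ 1 := fun _ =>
  (ContinuousAlternatingMap.ofSubsingleton ℝ ℝ ℂ (0 : Fin 1)
    (ContinuousLinearMap.toSpanSingleton ℝ Complex.I) : ℝ [⋀^Fin 1]→L[ℝ] ℂ)

theorem lineForm_apply (s : ℝ) (v : Fin 1 → ℝ) :
    (lineForm s : ℝ [⋀^Fin 1]→L[ℝ] ℂ) v = v 0 • Complex.I := rfl

theorem inChart_lineForm (x : ℝ) : lineForm.inChart x = fun y => lineForm y := by
  funext y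
  refine ContinuousAlternatingMap.ext fun v => ?_
  rw [inChart_apply]
  refine apply_congr lineForm (by rw [extChartAt_model_space_eq_id]; rfl) fun i => ?_
  have h : ((extChartAt 𝓘(ℝ, ℝ) x).symm : ℝ → ℝ) = id := by
    rw [extChartAt_model_space_eq_id]
    rfl
  rw [h]
  exact congrArg (fun L : ℝ →L[ℝ] ℝ => L (v i)) (mfderiv_id (I := 𝓘(ℝ, ℝ)) (x := y))

theorem smoothAt_lineForm (x : ℝ) : lineForm.SmoothAt x := by
  rw [SmoothAt, inChart_lineForm]
  exact contDiffAt_const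

theorem d_lineForm : lineForm.d = 0 := by
  funext x
  refine ext_apply fun v => ?_
  have h : extDeriv (lineForm.inChart x) (extChartAt 𝓘(ℝ, ℝ) x x) = 0 := by
    rw [inChart_lineForm]
    exact extDeriv_const (E := ℝ) (V := ℂ) (n := 1) (lineForm 0) _
  exact (d_apply _ x v).trans (congrArg (fun L : ℝ [⋀^Fin 2]→L[ℝ] ℂ => L _) h)

end DiffForm

/-! ### Comparison of two lifts of the same map -/

namespace CentralExtension

open DiffForm

variable {E : Type*} [NormedAddCommGroup E] [NormedSpace ℝ E]
  {H : Type*} [TopologicalSpace H]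
  {E' : Type*} [NormedAddCommGroup E'] [NormedSpace ℝ E']
  {H' : Type*} [TopologicalSpace H']
  {I : ModelWithCorners ℝ E H} {I' : ModelWithCorners ℝ E' H'}
  {G : Type*} [TopologicalSpace G] [ChartedSpace H G] [Group G]
  {Ghat : Type*} [TopologicalSpace Ghat] [ChartedSpace H' Ghat] [Group Ghat]
  (X : CentralExtension I I' G Ghat)
  {F : Type*} [NormedAddCommGroup F] [NormedSpace ℝ F] {K : Type*} [TopologicalSpace K]
  {J : ModelWithCorners ℝ F K} {M : Type*} [TopologicalSpace M] [ChartedSpace K M]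

theorem contMDiff_ι_exp : ContMDiff 𝓘(ℝ, ℝ) I' ∞ (fun t : ℝ => X.ι (Circle.exp t)) :=
  X.contMDiff_ι.comp contMDiff_circleExp

theorem exists_eq_mul_ι {a b : Ghat} (h : X.ρ a = X.ρ b) : ∃ u, b = a * X.ι u := by
  have : a⁻¹ * b ∈ X.ι.range := by
    rw [X.range_ι, MonoidHom.mem_ker, map_mul, map_inv, h, inv_mul_cancel]
  obtain ⟨u, hu⟩ := this
  exact ⟨u, by rw [hu, mul_inv_cancel_left]⟩

variable {X}

/-- In a local fibre coordinate u the quotient of the two lifts is u(a)⁻¹ u(a'), a smooth circle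
valued function, which has a smooth local logarithm. -/
theorem exists_eq_mul_exp {a a' : M → Ghat} {x₀ : M} (ha : ContMDiffAt J I' ∞ a x₀)
    (ha' : ContMDiffAt J I' ∞ a' x₀) (h : ∀ᶠ x in 𝓝 x₀, X.ρ (a' x) = X.ρ (a x)) :
    ∃ t : M → ℝ, ContMDiffAt J 𝓘(ℝ, ℝ) ∞ t x₀ ∧
      ∀ᶠ x in 𝓝 x₀, a' x = a x * X.ι (Circle.exp (t x)) := by
  obtain ⟨U, hU, hgU, η, u, hη, hu, hρη, hηu⟩ := X.locally_trivial (X.ρ (a x₀))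
  have hV : IsOpen (X.ρ ⁻¹' U) := hU.preimage X.contMDiff_ρ.continuous
  have hu₁ : ContMDiffAt J (𝓡 1) ∞ (fun x => u (a x)) x₀ :=
    ContMDiffAt.comp x₀ ((hu _ hgU).contMDiffAt (hV.mem_nhds hgU)) ha
  have hg' : a' x₀ ∈ X.ρ ⁻¹' U := by
    rw [Set.mem_preimage, h.self_of_nhds]
    exact hgU
  have hu₂ : ContMDiffAt J (𝓡 1) ∞ (fun x => u (a' x)) x₀ :=
    ContMDiffAt.comp x₀ ((hu _ hg').contMDiffAt (hV.mem_nhds hg')) ha'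
  have : LieGroup (𝓡 1) ∞ Circle := inferInstance
  obtain ⟨t, ht, htw⟩ := (hu₁.inv.mul hu₂).exists_circleExp_eq
  refine ⟨t, ht, ?_⟩
  filter_upwards [h, ha.continuousAt.preimage_mem_nhds (hV.mem_nhds hgU)] with x hx hxU
  have e₁ := hηu (a x) hxU
  have e₂ := hηu (a' x) (by rw [Set.mem_preimage, hx]; exact hxU)
  have e₃ : Circle.exp (t x) = (u (a x))⁻¹ * u (a' x) := (htw x).symm
  rw [e₃, map_mul, map_inv]
  rw [hx] at e₂
  exact e₂.trans (by rw [eq_mul_inv_of_mul_eq e₁.symm, mul_assoc])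

variable [LieGroup I' ∞ Ghat]

/-- Verticality prescribes θ only at parameter 0 of an orbit. The value at t follows by restarting
the orbit at the point `b * X.ι (Circle.exp t)`. -/
theorem IsConnection.pullback_fiber {θ : DiffForm I' Ghat 1} (hθ : X.IsConnection θ) (b : Ghat)
    (t : ℝ) : θ.pullback (fun s : ℝ => b * X.ι (Circle.exp s)) t = lineForm t := by
  have h : (fun s : ℝ => b * X.ι (Circle.exp s)) =
      fun s => (fun r : ℝ => b * X.ι (Circle.exp t) * X.ι (Circle.exp r)) (s - t) := by
    funext s
    simp only
    rw [mul_assoc, ← map_mul, ← Circle.exp_add, add_sub_cancel]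
  have hd : MDifferentiable 𝓘(ℝ, ℝ) I'
      (fun r : ℝ => b * X.ι (Circle.exp t) * X.ι (Circle.exp r)) :=
    ((contMDiff_const (c := b * X.ι (Circle.exp t))).mul X.contMDiff_ι_exp).mdifferentiable
      (by simp)
  have hs : DifferentiableAt ℝ (fun s : ℝ => s - t) t := differentiableAt_id.sub_const t
  rw [h, pullback_comp (I' := 𝓘(ℝ, ℝ)) (f := fun s : ℝ => s - t) θ (hd _) hs.mdifferentiableAt]
  refine ext_apply fun v => ?_
  have hv := hθ.vertical (b * X.ι (Circle.exp t))
  have hw : ∀ i, (mfderiv 𝓘(ℝ, ℝ) 𝓘(ℝ, ℝ) (fun s : ℝ => s - t) t : ℝ →L[ℝ] ℝ) (v i) =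
      v 0 • (1 : ℝ) := by
    intro i
    rw [mfderiv_eq_fderiv, fderiv_sub_const, Subsingleton.elim i 0, smul_eq_mul, mul_one]
    exact congrArg (fun L : ℝ →L[ℝ] ℝ => L (v 0)) fderiv_id
  refine (apply_congr (E := ℝ) (pullback (fun r : ℝ => b * X.ι (Circle.exp t) * X.ι (Circle.exp r)) θ)
    (sub_self t) hw).trans ?_
  exact (oneForm_map_smul
    (pullback (fun r : ℝ => b * X.ι (Circle.exp t) * X.ι (Circle.exp r)) θ 0) (v 0)).trans
    (congrArg (v 0 • ·) hv)

/-- The map is y ↦ (b y, t y) followed by (a, s) ↦ a · ι(exp s), whose derivative is the sum of its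
two partial derivatives. Invariance of θ evaluates the first part, restriction of θ to a fibre the
second. -/
theorem IsConnection.pullback_mul_exp {θ : DiffForm I' Ghat 1} (hθ : X.IsConnection θ)
    {b : M → Ghat} {t : M → ℝ} {x : M} (hb : MDifferentiableAt J I' b x)
    (ht : MDifferentiableAt J 𝓘(ℝ, ℝ) t x) :
    θ.pullback (I := J) (fun y => b y * X.ι (Circle.exp (t y))) x =
      θ.pullback b x + lineForm.pullback t x := by
  refine ext_apply fun v => ?_
  have hΦ : ContMDiff (I'.prod 𝓘(ℝ, ℝ)) I' ∞
      (fun p : Ghat × ℝ => p.1 * X.ι (Circle.exp p.2)) :=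
    contMDiff_fst.mul (X.contMDiff_ι_exp.comp contMDiff_snd)
  have hΦ' := (hΦ.mdifferentiable (by simp)) (b x, t x)
  have e₁ : ∀ w : F,
      (mfderiv J I' (fun y => b y * X.ι (Circle.exp (t y))) x : F →L[ℝ] E') w =
        (mfderiv I' I' (fun a => a * X.ι (Circle.exp (t x))) (b x) : E' →L[ℝ] E')
            ((mfderiv J I' b x : F →L[ℝ] E') w) +
          (mfderiv 𝓘(ℝ, ℝ) I' (fun s => b x * X.ι (Circle.exp s)) (t x) : ℝ →L[ℝ] E')
            ((mfderiv J 𝓘(ℝ, ℝ) t x : F →L[ℝ] ℝ) w) := by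
    intro w
    have h₁ := mfderiv_comp (I' := I'.prod 𝓘(ℝ, ℝ)) (f := fun y => (b y, t y)) x hΦ'
      (hb.prodMk ht)
    have h₂ := mfderiv_prod_eq_add_apply (E := E') (E' := ℝ) (I := I') (I' := 𝓘(ℝ, ℝ)) (p := (b x, t x))
      (v := ((mfderiv J I' b x : F →L[ℝ] E') w, (mfderiv J 𝓘(ℝ, ℝ) t x : F →L[ℝ] ℝ) w)) hΦ'
    have h₃ := hb.mfderiv_prod ht
    refine (congrArg (fun L : F →L[ℝ] E' => L w) h₁).trans (Eq.trans ?_ h₂)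
    exact congrArg (mfderiv (I'.prod 𝓘(ℝ, ℝ)) I' (fun p : Ghat × ℝ => p.1 * X.ι (Circle.exp p.2))
      (b x, t x) : E' × ℝ →L[ℝ] E') (congrArg (fun L : F →L[ℝ] E' × ℝ => L w) h₃)
  refine (apply_congr θ rfl fun i => e₁ (v i)).trans ?_
  refine (oneForm_map_add (V := E') _ _ _).trans (congrArg₂ (· + ·) ?_ ?_)
  · exact congrArg (fun L : E' [⋀^Fin 1]→L[ℝ] ℂ => L fun i => (mfderiv J I' b x : F →L[ℝ] E') (v i))
      (congrFun (hθ.invariant (Circle.exp (t x))) (b x))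
  · exact congrArg (fun L : ℝ [⋀^Fin 1]→L[ℝ] ℂ =>
      L fun i => (mfderiv J 𝓘(ℝ, ℝ) t x : F →L[ℝ] ℝ) (v i)) (hθ.pullback_fiber (b x) (t x))

end CentralExtension

namespace CentralExtension

open DiffForm

variable {E : Type*} [NormedAddCommGroup E] [NormedSpace ℝ E]
  {H : Type*} [TopologicalSpace H]
  {E' : Type*} [NormedAddCommGroup E'] [NormedSpace ℝ E']
  {H' : Type*} [TopologicalSpace H']
  {I : ModelWithCorners ℝ E H} {I' : ModelWithCorners ℝ E' H'}
  {G : Type*} [TopologicalSpace G] [ChartedSpace H G] [Group G]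
  {Ghat : Type*} [TopologicalSpace Ghat] [ChartedSpace H' Ghat] [Group Ghat]
  {X : CentralExtension I I' G Ghat}
  {F : Type*} [NormedAddCommGroup F] [NormedSpace ℝ F] {K : Type*} [TopologicalSpace K]
  {J : ModelWithCorners ℝ F K} {M : Type*} [TopologicalSpace M] [ChartedSpace K M]

theorem IsConnection.exists_pullback_eq [LieGroup I' ∞ Ghat] [IsManifold J ∞ M]
    {θ : DiffForm I' Ghat 1} (hθ : X.IsConnection θ)
    {a a' : M → Ghat} {x₀ : M} (ha : ContMDiffAt J I' ∞ a x₀)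
    (ha' : ContMDiffAt J I' ∞ a' x₀) (h : ∀ᶠ x in 𝓝 x₀, X.ρ (a' x) = X.ρ (a x)) :
    ∃ t : M → ℝ, ContMDiffAt J 𝓘(ℝ, ℝ) ∞ t x₀ ∧
      (∀ᶠ x in 𝓝 x₀, a' x = a x * X.ι (Circle.exp (t x))) ∧
      ∀ᶠ x in 𝓝 x₀, θ.pullback (I := J) a' x = θ.pullback a x + lineForm.pullback t x := by
  obtain ⟨t, ht, h'⟩ := exists_eq_mul_exp ha ha' h
  refine ⟨t, ht, h', ?_⟩
  have h₁ := (contMDiffAt_iff_contMDiffAt_nhds (n := 1) (by simp)).1 (ha.of_le (by simp))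
  have h₂ := (contMDiffAt_iff_contMDiffAt_nhds (n := 1) (by simp)).1 (ht.of_le (by simp))
  filter_upwards [h'.eventually_nhds, h₁, h₂] with x hx hx₁ hx₂
  rw [pullback_congr (g := fun y => a y * X.ι (Circle.exp (t y))) θ hx,
    hθ.pullback_mul_exp (hx₁.mdifferentiableAt (by simp)) (hx₂.mdifferentiableAt (by simp))]

/-! ### The Chern form -/

variable (X) in
/-- `η` is a smooth section of the bundle `Ĝ → G` near `g`. -/
def IsSectionAt (η : G → Ghat) (g : G) : Prop :=
  ContMDiffAt I I' ∞ η g ∧ ∀ᶠ y in 𝓝 g, X.ρ (η y) = y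

variable (X) in
theorem exists_isSectionAt (g : G) :
    ∃ (U : Set G) (η : G → Ghat), IsOpen U ∧ g ∈ U ∧ (∀ y ∈ U, X.IsSectionAt η y) ∧
      (∀ y ∈ U, X.ρ (η y) = y) ∧ ContMDiffOn I I' ∞ η U := by
  obtain ⟨U, hU, hgU, η, u, hη, -, hρη, -⟩ := X.locally_trivial g
  exact ⟨U, η, hU, hgU, fun y hy => ⟨(hη y hy).contMDiffAt (hU.mem_nhds hy),
    Filter.eventually_of_mem (hU.mem_nhds hy) hρη⟩, hρη, hη⟩

theorem IsSectionAt.pullback_pullback {η : G → Ghat} {g : G} (hη : X.IsSectionAt η g) {n : ℕ}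
    (c : DiffForm I G n) : (c.pullback (I := I') X.ρ).pullback η g = c g := by
  rw [← pullback_comp c ((X.contMDiff_ρ _).mdifferentiableAt (by simp))
    (hη.1.mdifferentiableAt (by simp)), pullback_congr (g := fun y => y) c hη.2, pullback_id]

theorem IsChernForm.eq {θ : DiffForm I' Ghat 1} {c : DiffForm I G 2} (hc : X.IsChernForm θ c)
    {η : G → Ghat} {g : G} (hη : X.IsSectionAt η g) :
    c g = (((-1 / (2 * (Real.pi : ℂ) * Complex.I)) • θ.d).pullback η g) := by
  rw [← hc.2, hη.pullback_pullback]

variable [I'.Boundaryless] [LieGroup I' ∞ Ghat]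

/-- Both η ∘ ρ and the identity of `Ghat` are lifts of ρ, so their pullbacks of θ differ by the
closed form i dt. This is the statement that dθ comes from the base. -/
theorem IsConnection.pullback_pullback_d {θ : DiffForm I' Ghat 1} (hθ : X.IsConnection θ)
    {η : G → Ghat} {a : Ghat} (hη : X.IsSectionAt η (X.ρ a)) :
    (θ.d.pullback (I := I) η).pullback X.ρ a = θ.d a := by
  have hs := isSmooth_iff.1 hθ.smooth
  have hf : ContMDiffAt I' I' ∞ (fun b => η (X.ρ b)) a := hη.1.comp a (X.contMDiff_ρ a)
  have hρ := (X.contMDiff_ρ.continuous.tendsto a).eventually hη.2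
  obtain ⟨t, ht, -, h⟩ := hθ.exists_pullback_eq (a := fun b => b) contMDiffAt_id hf hρ
  rw [pullback_id] at h
  rw [← pullback_comp θ.d (hη.1.mdifferentiableAt (by simp))
      ((X.contMDiff_ρ _).mdifferentiableAt (by simp)), ← (hs _).d_pullback hf,
    d_congr (β := θ + lineForm.pullback t) h,
    (hs a).d_add ((smoothAt_lineForm _).pullback ht), (smoothAt_lineForm _).d_pullback ht,
    d_lineForm, pullback_zero]
  exact add_zero (θ.d a)

theorem IsConnection.pullback_d_eq {θ : DiffForm I' Ghat 1} (hθ : X.IsConnection θ)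
    {η η' : G → Ghat} {g : G} (hη : X.IsSectionAt η g) (hη' : X.IsSectionAt η' g) :
    θ.d.pullback (I := I) η g = θ.d.pullback η' g := by
  have hg : X.ρ (η' g) = g := hη'.2.self_of_nhds
  rw [← hη'.pullback_pullback (θ.d.pullback η)]
  exact pullback_congr_form (hθ.pullback_pullback_d (by rwa [hg]))

variable [I.Boundaryless] [LieGroup I ∞ G]

theorem IsConnection.existsUnique_isChernForm {θ : DiffForm I' Ghat 1} (hθ : X.IsConnection θ) :
    ∃! c : DiffForm I G 2, X.IsChernForm θ c := by
  choose U η hU hgU hη hρη _ using X.exists_isSectionAt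
  -- At each g the value is computed with a section chosen for g. Independence of the section lets
  -- one fixed section compute all nearby values, which gives smoothness.
  refine ⟨fun g => (((-1 / (2 * (Real.pi : ℂ) * Complex.I)) • θ.d).pullback (η g) g), ⟨?_, ?_⟩, ?_⟩
  · rw [isSmooth_iff]
    intro g
    have h : (((-1 / (2 * (Real.pi : ℂ) * Complex.I)) • θ.d).pullback (I := I) (η g)).SmoothAt g :=
      ((isSmooth_iff.1 hθ.smooth.d _).smul _).pullback (hη g g (hgU g)).1
    refine h.congr ?_
    filter_upwards [(hU g).mem_nhds (hgU g)] with y hy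
    rw [pullback_smul, pullback_smul]
    exact congrArg ((-1 / (2 * (Real.pi : ℂ) * Complex.I)) • ·) (hθ.pullback_d_eq (hη y y (hgU y)) (hη g y hy))
  · funext a
    have h := hθ.pullback_pullback_d (hη (X.ρ a) (X.ρ a) (hgU _))
    exact congrArg ((-1 / (2 * (Real.pi : ℂ) * Complex.I)) • ·) h
  · intro c hc
    funext g
    exact hc.eq (hη g g (hgU g))

/-- The pullback of dc by ρ is a multiple of d(dθ) = 0, and pulling back further along a local
section recovers dc. -/
theorem IsChernForm.d_eq_zero {θ : DiffForm I' Ghat 1} (hθ : X.IsConnection θ)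
    {c : DiffForm I G 2} (hc : X.IsChernForm θ c) : c.d = 0 := by
  funext g
  obtain ⟨U, η, hU, hgU, hη, -, -⟩ := X.exists_isSectionAt g
  rw [← (hη g hgU).pullback_pullback c.d]
  have h : (c.d.pullback (I := I') X.ρ) (η g) = 0 := by
    rw [← (isSmooth_iff.1 hc.1 _).d_pullback (X.contMDiff_ρ _), hc.2,
      (isSmooth_iff.1 hθ.smooth.d _).d_smul, hθ.smooth.d_d]
    exact smul_zero (M := ℂ) (A := E' [⋀^Fin 3]→L[ℝ] ℂ) _
  rw [pullback_congr_form (β := 0) h]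
  rfl

end CentralExtension

namespace CentralExtension

open DiffForm

variable {E : Type*} [NormedAddCommGroup E] [NormedSpace ℝ E]
  {H : Type*} [TopologicalSpace H]
  {E' : Type*} [NormedAddCommGroup E'] [NormedSpace ℝ E']
  {H' : Type*} [TopologicalSpace H']
  {I : ModelWithCorners ℝ E H} {I' : ModelWithCorners ℝ E' H'}
  {G : Type*} [TopologicalSpace G] [ChartedSpace H G] [Group G]
  {Ghat : Type*} [TopologicalSpace Ghat] [ChartedSpace H' Ghat] [Group Ghat]
  {X : CentralExtension I I' G Ghat}
  {F : Type*} [NormedAddCommGroup F] [NormedSpace ℝ F] {K : Type*} [TopologicalSpace K]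
  {J : ModelWithCorners ℝ F K} {M : Type*} [TopologicalSpace M] [ChartedSpace K M]

/-! ### Pullbacks of the induced connections -/

theorem exp_sum_units_mul {k : ℕ} (e : Fin k → ℤˣ) (t : Fin k → ℝ) :
    Circle.exp (∑ j, ((e j : ℤ) : ℝ) * t j) = ∏ j, Circle.exp (t j) ^ (e j : ℤ) := by
  have h : ∀ s : Finset (Fin k), Circle.exp (∑ j ∈ s, ((e j : ℤ) : ℝ) * t j) =
      ∏ j ∈ s, Circle.exp (t j) ^ (e j : ℤ) := by
    intro s
    induction s using Finset.induction_on with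
    | empty => simp
    | insert j s hj ih =>
      rw [Finset.sum_insert hj, Finset.prod_insert hj, Circle.exp_add, ih, Circle.exp_intCast_mul]
  exact h Finset.univ

theorem hasMFDerivAt_sum_units_mul {k : ℕ} (e : Fin k → ℤˣ) {t : Fin k → M → ℝ} {x : M}
    {L : Fin k → F →L[ℝ] ℝ} (ht : ∀ j, HasMFDerivAt J 𝓘(ℝ, ℝ) (t j) x (L j)) :
    HasMFDerivAt J 𝓘(ℝ, ℝ) (fun y => ∑ j, ((e j : ℤ) : ℝ) * t j y) x
      (∑ j, ((e j : ℤ) : ℝ) • L j) := by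
  have h := HasMFDerivAt.sum (t := Finset.univ) fun j _ => (ht j).const_smul ((e j : ℤ) : ℝ)
  have hT : (∑ j, ((e j : ℤ) : ℝ) • t j) = fun y => ∑ j, ((e j : ℤ) : ℝ) * t j y := by
    funext y
    simp
  rw [hT] at h
  exact h

theorem pullback_lineForm_apply {t : M → ℝ} {x : M} {L : F →L[ℝ] ℝ}
    (hL : mfderiv J 𝓘(ℝ, ℝ) t x = L) (v : Fin 1 → F) :
    (lineForm.pullback (I := J) t x : F [⋀^Fin 1]→L[ℝ] ℂ) v = L (v 0) • Complex.I := by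
  rw [← hL]
  rfl

theorem sum_smul_pullback_lineForm {k : ℕ} (e : Fin k → ℤˣ) {t : Fin k → M → ℝ} {x : M}
    (ht : ∀ j, MDifferentiableAt J 𝓘(ℝ, ℝ) (t j) x) :
    ∑ j, ((e j : ℤ) : ℂ) • lineForm.pullback (I := J) (t j) x =
      lineForm.pullback (fun y => ∑ j, ((e j : ℤ) : ℝ) * t j y) x := by
  obtain ⟨L, hL⟩ : ∃ L : Fin k → F →L[ℝ] ℝ, ∀ j, HasMFDerivAt J 𝓘(ℝ, ℝ) (t j) x (L j) :=
    ⟨_, fun j => (ht j).hasMFDerivAt⟩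
  refine ext_apply fun v => ?_
  have h₁ := pullback_lineForm_apply (hasMFDerivAt_sum_units_mul e hL).mfderiv v
  have h₂ : ∑ j, ((e j : ℤ) : ℂ) • (L j (v 0) • Complex.I) =
      (∑ j, ((e j : ℤ) : ℝ) • L j) (v 0) • Complex.I := by
    rw [sum_apply, Finset.sum_smul]
    refine Finset.sum_congr rfl fun j _ => ?_
    simp [mul_assoc]
  refine Eq.trans ?_ (h₂.trans h₁.symm)
  refine (ContinuousAlternatingMap.sum_apply (M := F) (N := ℂ) _ v).trans ?_
  refine Finset.sum_congr rfl fun j _ => ?_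
  exact congrArg (((e j : ℤ) : ℂ) • ·) (pullback_lineForm_apply (hL j).mfderiv v)

theorem IsChernForm.pullback_eq {θ : DiffForm I' Ghat 1} {c : DiffForm I G 2}
    (hc : X.IsChernForm θ c) {a : M → Ghat} {f : M → G} {x : M} (ha : MDifferentiableAt J I' a x)
    (h : ∀ᶠ y in 𝓝 x, X.ρ (a y) = f y) :
    c.pullback (I := J) f x = (-1 / (2 * (Real.pi : ℂ) * Complex.I)) • θ.d.pullback a x := by
  rw [← pullback_congr c h, pullback_comp c ((X.contMDiff_ρ _).mdifferentiableAt (by simp)) ha,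
    hc.2]
  rfl

section Lift

variable {k : ℕ} {e : Fin k → ℤˣ} {f : Fin k → M → G} {s : ∀ x, X.TensorFiber e f x}

variable [LieGroup I' ∞ Ghat] [IsManifold J ∞ M]

/-- This makes the pullback of the induced connection well defined: the discrepancy between two
lifts is i d(Σ eⱼ tⱼ), and Σ eⱼ tⱼ has exponential 1 near x. -/
theorem IsConnection.sum_pullback_eq {θ : DiffForm I' Ghat 1} (hθ : X.IsConnection θ)
    {U U' : Set M} {a a' : Fin k → M → Ghat} (ha : X.IsSmoothLift J s U a)
    (ha' : X.IsSmoothLift J s U' a') {x : M} (hx : x ∈ U) (hx' : x ∈ U') :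
    ∑ j, ((e j : ℤ) : ℂ) • θ.pullback (I := J) (a' j) x =
      ∑ j, ((e j : ℤ) : ℂ) • θ.pullback (a j) x := by
  have hU : ∀ᶠ y in 𝓝 x, y ∈ U := ha.isOpen.mem_nhds hx
  have hU' : ∀ᶠ y in 𝓝 x, y ∈ U' := ha'.isOpen.mem_nhds hx'
  have hc : ∀ j, ContMDiffAt J I' ∞ (a j) x := fun j =>
    (ha.smooth j x hx).contMDiffAt (ha.isOpen.mem_nhds hx)
  have hc' : ∀ j, ContMDiffAt J I' ∞ (a' j) x := fun j =>
    (ha'.smooth j x hx').contMDiffAt (ha'.isOpen.mem_nhds hx')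
  have hρ : ∀ j, ∀ᶠ y in 𝓝 x, X.ρ (a' j y) = X.ρ (a j y) := by
    intro j
    filter_upwards [hU, hU'] with y hy hy'
    obtain ⟨h, -⟩ := ha.eq_tmk y hy
    obtain ⟨h', -⟩ := ha'.eq_tmk y hy'
    rw [h, h']
  choose t ht ht₁ ht₂ using fun j => hθ.exists_pullback_eq (hc j) (hc' j) (hρ j)
  have htd : ∀ j, MDifferentiableAt J 𝓘(ℝ, ℝ) (t j) x := fun j =>
    (ht j).mdifferentiableAt (by simp)
  have hexp : ∀ᶠ y in 𝓝 x, Circle.exp (∑ j, ((e j : ℤ) : ℝ) * t j y) = 1 := by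
    filter_upwards [hU, hU', Filter.eventually_all.2 ht₁] with y hy hy' hty
    obtain ⟨h, hs⟩ := ha.eq_tmk y hy
    obtain ⟨h', hs'⟩ := ha'.eq_tmk y hy'
    -- Equality in the tensor product provides circle elements with signed product 1; injectivity of
    -- ι identifies them with the exponentials of the tⱼ.
    obtain ⟨u, hu, hua⟩ := Quotient.exact (hs.symm.trans hs')
    have hut : ∀ j, u j = Circle.exp (t j y) := fun j =>
      X.ι_injective (mul_left_cancel ((hua j).symm.trans (hty j)))
    rw [exp_sum_units_mul, ← hu]
    exact Finset.prod_congr rfl fun j _ => by rw [hut j]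
  have hT : MDifferentiableAt J 𝓘(ℝ, ℝ) (fun y => ∑ j, ((e j : ℤ) : ℝ) * t j y) x :=
    (hasMFDerivAt_sum_units_mul e fun j => (htd j).hasMFDerivAt).mdifferentiableAt
  -- Instead of arguing that Σ eⱼ tⱼ is locally constant, multiply the constant lift 1 by its
  -- exponential: the lift is locally unchanged, so the correction term of `pullback_mul_exp` is
  -- zero.
  have hzero : lineForm.pullback (I := J) (fun y => ∑ j, ((e j : ℤ) : ℝ) * t j y) x = 0 := by
    have h₁ := hθ.pullback_mul_exp (J := J) (b := fun _ => 1) mdifferentiableAt_const hT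
    have h₂ : θ.pullback (I := J) (fun _ : M => (1 : Ghat)) x = 0 := by
      refine ext_apply fun v => ?_
      refine (apply_congr θ (w := fun _ => (0 : E')) rfl fun i => ?_).trans
        (ContinuousAlternatingMap.map_zero (M := E') (N := ℂ) _)
      exact congrArg (fun L : F →L[ℝ] E' => L (v i)) mfderiv_const
    rw [h₂, zero_add, pullback_congr (g := fun _ => 1) θ, h₂] at h₁
    · exact h₁.symm
    · filter_upwards [hexp] with y hy
      rw [hy, map_one, mul_one]
  have h₂ : ∀ j, ((e j : ℤ) : ℂ) • θ.pullback (I := J) (a' j) x =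
      ((e j : ℤ) : ℂ) • θ.pullback (a j) x + ((e j : ℤ) : ℂ) • lineForm.pullback (t j) x := by
    intro j
    rw [(ht₂ j).self_of_nhds]
    exact smul_add (A := F [⋀^Fin 1]→L[ℝ] ℂ) _ _ _
  rw [Finset.sum_congr rfl fun j _ => h₂ j, Finset.sum_add_distrib,
    sum_smul_pullback_lineForm e htd, hzero, add_zero]

variable [J.Boundaryless] [I'.Boundaryless]

theorem IsSmoothLift.smoothAt_sum {θ : DiffForm I' Ghat 1} (hθ : X.IsConnection θ)
    {U : Set M} {a : Fin k → M → Ghat} (ha : X.IsSmoothLift J s U a) {x : M} (hx : x ∈ U) :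
    (∑ j, ((e j : ℤ) : ℂ) • θ.pullback (I := J) (a j)).SmoothAt x :=
  SmoothAt.sum _ fun j _ => ((isSmooth_iff.1 hθ.smooth _).pullback
    ((ha.smooth j x hx).contMDiffAt (ha.isOpen.mem_nhds hx))).smul _

theorem IsConnection.existsUnique_isConnectionPullback {θ : DiffForm I' Ghat 1}
    (hθ : X.IsConnection θ) (hs : X.IsSmoothSection J s) :
    ∃! σ, X.IsConnectionPullback J θ s σ := by
  choose U a hxU ha using hs
  have key : ∀ V b, X.IsSmoothLift J s V b → ∀ x ∈ V,
      ∑ j, ((e j : ℤ) : ℂ) • θ.pullback (I := J) (a x j) x =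
        ∑ j, ((e j : ℤ) : ℂ) • θ.pullback (b j) x := fun V b hb x hx =>
    hθ.sum_pullback_eq hb (ha x) hx (hxU x)
  refine ⟨fun x => ∑ j, ((e j : ℤ) : ℂ) • θ.pullback (a x j) x, ⟨?_, ?_, key⟩, ?_⟩
  · exact fun x => ⟨U x, a x, hxU x, ha x⟩
  · rw [isSmooth_iff]
    intro x
    refine ((ha x).smoothAt_sum hθ (hxU x)).congr ?_
    filter_upwards [(ha x).isOpen.mem_nhds (hxU x)] with y hy
    rw [key (U x) (a x) (ha x) y hy, Finset.sum_apply]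
    rfl
  · intro σ hσ
    funext x
    exact hσ.eq_sum (U x) (a x) (ha x) x (hxU x)

theorem IsConnectionPullback.d_eq {θ : DiffForm I' Ghat 1} (hθ : X.IsConnection θ)
    {σ : DiffForm J M 1} (hσ : X.IsConnectionPullback J θ s σ)
    {U : Set M} {a : Fin k → M → Ghat} (ha : X.IsSmoothLift J s U a) {x : M} (hx : x ∈ U) :
    σ.d x = ∑ j, ((e j : ℤ) : ℂ) • θ.d.pullback (I := J) (a j) x := by
  have hc : ∀ j, ContMDiffAt J I' ∞ (a j) x := fun j =>
    (ha.smooth j x hx).contMDiffAt (ha.isOpen.mem_nhds hx)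
  have hs := isSmooth_iff.1 hθ.smooth
  have h : ∀ᶠ y in 𝓝 x, σ y = (∑ j, ((e j : ℤ) : ℂ) • θ.pullback (I := J) (a j)) y := by
    filter_upwards [ha.isOpen.mem_nhds hx] with y hy
    rw [hσ.eq_sum U a ha y hy, Finset.sum_apply]
    rfl
  rw [d_congr h, SmoothAt.d_sum _ fun j _ => ((hs _).pullback (hc j)).smul _]
  refine Finset.sum_congr rfl fun j _ => ?_
  rw [((hs _).pullback (hc j)).d_smul, (hs _).d_pullback (hc j)]

end Lift

end CentralExtension

/-! ### Base change and smooth lifts of the trivial sections -/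

namespace CentralExtension

open DiffForm

variable {E : Type*} [NormedAddCommGroup E] [NormedSpace ℝ E]
  {H : Type*} [TopologicalSpace H]
  {E' : Type*} [NormedAddCommGroup E'] [NormedSpace ℝ E']
  {H' : Type*} [TopologicalSpace H']
  {I : ModelWithCorners ℝ E H} {I' : ModelWithCorners ℝ E' H'}
  {G : Type*} [TopologicalSpace G] [ChartedSpace H G] [Group G]
  {Ghat : Type*} [TopologicalSpace Ghat] [ChartedSpace H' Ghat] [Group Ghat]
  {X : CentralExtension I I' G Ghat}
  {F : Type*} [NormedAddCommGroup F] [NormedSpace ℝ F] {K : Type*} [TopologicalSpace K]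
  {J : ModelWithCorners ℝ F K} {M : Type*} [TopologicalSpace M] [ChartedSpace K M]
  {F' : Type*} [NormedAddCommGroup F'] [NormedSpace ℝ F'] {K' : Type*} [TopologicalSpace K']
  {J' : ModelWithCorners ℝ F' K'} {N : Type*} [TopologicalSpace N] [ChartedSpace K' N]

/-! ### Base change of sections -/

theorem IsSmoothLift.comp {k : ℕ} {e : Fin k → ℤˣ} {f : Fin k → M → G}
    {s : ∀ x, X.TensorFiber e f x} {U : Set M} {a : Fin k → M → Ghat}
    (ha : X.IsSmoothLift J s U a) {φ : N → M} (hφ : ContMDiff J' J ∞ φ) :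
    X.IsSmoothLift (e := e) (f := fun j y => f j (φ y)) J' (fun y => s (φ y)) (φ ⁻¹' U)
      (fun j y => a j (φ y)) where
  isOpen := ha.isOpen.preimage hφ.continuous
  smooth j := (ha.smooth j).comp hφ.contMDiffOn fun _ hy => hy
  eq_tmk y hy := ha.eq_tmk (φ y) hy

/-- The lift b over N need not be a composite of φ with a lift over M. This freedom allows the
pullbacks along all the faces and along γ to be computed from one common choice of lifts. -/
theorem IsConnectionPullback.pullback_eq_sum [LieGroup I' ∞ Ghat] [IsManifold J' ∞ N]
    {k : ℕ} {e : Fin k → ℤˣ} {f : Fin k → M → G} {s : ∀ x, X.TensorFiber e f x}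
    {θ : DiffForm I' Ghat 1} (hθ : X.IsConnection θ) {σ : DiffForm J M 1}
    (hσ : X.IsConnectionPullback J θ s σ) {φ : N → M} (hφ : ContMDiff J' J ∞ φ)
    {V : Set N} {b : Fin k → N → Ghat}
    (hb : X.IsSmoothLift (e := e) (f := fun j y => f j (φ y)) J' (fun y => s (φ y)) V b)
    {y : N} (hy : y ∈ V) :
    σ.pullback (I := J') φ y = ∑ j, ((e j : ℤ) : ℂ) • θ.pullback (b j) y := by
  obtain ⟨U, a, hU, ha⟩ := hσ.smooth_section (φ y)
  rw [← hθ.sum_pullback_eq hb (ha.comp hφ) hy hU,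
    pullback_congr_form (β := ∑ j, ((e j : ℤ) : ℂ) • θ.pullback (I := J) (a j))]
  · rw [pullback_sum, Finset.sum_apply]
    refine Finset.sum_congr rfl fun j _ => ?_
    rw [pullback_comp θ (((ha.smooth j _ hU).contMDiffAt
      (ha.isOpen.mem_nhds hU)).mdifferentiableAt (by simp)) ((hφ y).mdifferentiableAt (by simp))]
    rfl
  · rw [hσ.eq_sum U a ha _ hU, Finset.sum_apply]
    rfl

/-! ### The trivial sections -/

theorem ρ_lift (g : G) : X.ρ (X.lift g) = g := Function.surjInv_eq X.ρ_surjective g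

theorem isSmoothLift_deltaSection [LieGroup I' ∞ Ghat] {φ : N → Fin 2 → G} {V : Set N}
    (hV : IsOpen V) {p q : N → Ghat} (hp : ContMDiffOn J' I' ∞ p V) (hq : ContMDiffOn J' I' ∞ q V)
    (hρp : ∀ y ∈ V, X.ρ (p y) = φ y 0) (hρq : ∀ y ∈ V, X.ρ (q y) = φ y 1) :
    X.IsSmoothLift (e := deltaSign) (f := fun j y => deltaMap j (φ y)) J'
      (fun y => X.deltaSection (φ y)) V ![q, fun y => p y * q y, p] where
  isOpen := hV
  smooth j := by
    fin_cases j
    · exact hq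
    · exact hp.mul hq
    · exact hp
  eq_tmk y hy := by
    refine ⟨fun j => ?_, ?_⟩
    · fin_cases j
      · exact hρq y hy
      · exact (map_mul X.ρ _ _).trans (congrArg₂ _ (hρp y hy) (hρq y hy))
      · exact hρp y hy
    · obtain ⟨w, hw⟩ := X.exists_eq_mul_ι ((ρ_lift (X := X) (φ y 0)).trans (hρp y hy).symm)
      obtain ⟨z, hz⟩ := X.exists_eq_mul_ι ((ρ_lift (X := X) (φ y 1)).trans (hρq y hy).symm)
      -- Changing the lifts of the two entries by w and z changes their product by wz, by
      -- centrality; the signed product z · (wz)⁻¹ · w is 1.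
      refine Quotient.sound ⟨![z, w * z, w], ?_, fun j => ?_⟩
      · simp [Fin.prod_univ_three, deltaSign, mul_comm]
      · fin_cases j
        · exact hz
        · change p y * q y = X.lift (φ y 0) * X.lift (φ y 1) * X.ι (w * z)
          rw [hw, hz, map_mul, mul_assoc, mul_assoc, ← mul_assoc (X.ι w), X.central w, mul_assoc]
        · exact hw

theorem isSmoothLift_deltaBarSection [LieGroup I' ∞ Ghat] {φ : N → Fin (1 + 1) → G} {V : Set N}
    (hV : IsOpen V) {p q : N → Ghat} (hp : ContMDiffOn J' I' ∞ p V) (hq : ContMDiffOn J' I' ∞ q V)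
    (hρp : ∀ y ∈ V, X.ρ (p y) = φ y 0 * (φ y 1)⁻¹) (hρq : ∀ y ∈ V, X.ρ (q y) = φ y 1) :
    X.IsSmoothLift (e := deltaBarSign) (f := fun j y => deltaBarMap j (φ y)) J'
      (fun y => X.deltaBarSection (φ y)) V ![q, p, fun y => p y * q y] where
  isOpen := hV
  smooth j := by
    fin_cases j
    · exact hq
    · exact hp
    · exact hp.mul hq
  eq_tmk y hy := by
    refine ⟨fun j => ?_, ?_⟩
    · fin_cases j
      · exact hρq y hy
      · exact hρp y hy
      · exact (map_mul X.ρ _ _).trans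
          ((congrArg₂ _ (hρp y hy) (hρq y hy)).trans (inv_mul_cancel_right _ _))
    · obtain ⟨w, hw⟩ := X.exists_eq_mul_ι ((ρ_lift (X := X) _).trans (hρp y hy).symm)
      obtain ⟨z, hz⟩ := X.exists_eq_mul_ι ((ρ_lift (X := X) (φ y 1)).trans (hρq y hy).symm)
      -- The same computation with the product in the last slot: z · w · (wz)⁻¹ = 1.
      refine Quotient.sound ⟨![z, w, w * z], ?_, fun j => ?_⟩
      · simp [Fin.prod_univ_three, deltaBarSign, mul_comm z w]
      · fin_cases j
        · exact hz
        · exact hw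
        · change p y * q y = X.lift (φ y 0 * (φ y 1)⁻¹) * X.lift (φ y 1) * X.ι (w * z)
          rw [hw, hz, map_mul, mul_assoc, mul_assoc, ← mul_assoc (X.ι w), X.central w, mul_assoc]

theorem exists_local_lift {f : N → G} (hf : ContMDiff J' I ∞ f) (y : N) :
    ∃ (V : Set N) (p : N → Ghat), IsOpen V ∧ y ∈ V ∧ ContMDiffOn J' I' ∞ p V ∧
      ∀ z ∈ V, X.ρ (p z) = f z := by
  obtain ⟨U, η, hU, hy, -, hρ, hη⟩ := X.exists_isSectionAt (f y)
  exact ⟨f ⁻¹' U, fun z => η (f z), hU.preimage hf.continuous, hy,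
    hη.comp hf.contMDiffOn fun _ hz => hz, fun z hz => hρ _ hz⟩

variable [LieGroup I' ∞ Ghat]

theorem isSmoothSection_deltaSection :
    X.IsSmoothSection (ModelWithCorners.pi fun _ : Fin 2 => I) X.deltaSection := by
  intro g
  obtain ⟨V, p, hV, hgV, hp, hρp⟩ := exists_local_lift (X := X)
    (contMDiff_pi_apply (I := fun _ : Fin 2 => I) (M := fun _ => G) 0) g
  obtain ⟨W, q, hW, hgW, hq, hρq⟩ := exists_local_lift (X := X)
    (contMDiff_pi_apply (I := fun _ : Fin 2 => I) (M := fun _ => G) 1) g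
  exact ⟨V ∩ W, _, ⟨hgV, hgW⟩, isSmoothLift_deltaSection (φ := fun y => y) (hV.inter hW)
    (hp.mono Set.inter_subset_left) (hq.mono Set.inter_subset_right) (fun y hy => hρp y hy.1)
    fun y hy => hρq y hy.2⟩

variable [LieGroup I ∞ G]

theorem exists_isSmoothLift_deltaBarSection (h : Fin (1 + 1) → G) :
    ∃ (V : Set (Fin (1 + 1) → G)) (p q : (Fin (1 + 1) → G) → Ghat), h ∈ V ∧
      (∀ y ∈ V, X.ρ (p y) = y 0 * (y 1)⁻¹) ∧ (∀ y ∈ V, X.ρ (q y) = y 1) ∧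
      X.IsSmoothLift (ModelWithCorners.pi fun _ : Fin (1 + 1) => I) X.deltaBarSection V
        ![q, p, fun y => p y * q y] := by
  have h₀ := contMDiff_pi_apply (r := ∞) (I := fun _ : Fin (1 + 1) => I) (M := fun _ => G) 0
  have h₁ := contMDiff_pi_apply (r := ∞) (I := fun _ : Fin (1 + 1) => I) (M := fun _ => G) 1
  obtain ⟨V, p, hV, hgV, hp, hρp⟩ := exists_local_lift (X := X) (h₀.mul h₁.inv) h
  obtain ⟨W, q, hW, hgW, hq, hρq⟩ := exists_local_lift (X := X) h₁ h
  exact ⟨V ∩ W, p, q, ⟨hgV, hgW⟩, fun y hy => hρp y hy.1, fun y hy => hρq y hy.2,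
    isSmoothLift_deltaBarSection (φ := fun y => y) (hV.inter hW)
    (hp.mono Set.inter_subset_left) (hq.mono Set.inter_subset_right) (fun y hy => hρp y hy.1)
    fun y hy => hρq y hy.2⟩

theorem isSmoothSection_deltaBarSection :
    X.IsSmoothSection (ModelWithCorners.pi fun _ : Fin (1 + 1) => I) X.deltaBarSection := by
  intro h
  obtain ⟨V, p, q, hV, -, -, hl⟩ := exists_isSmoothLift_deltaBarSection (X := X) h
  exact ⟨V, _, hV, hl⟩

end CentralExtension

section Nerve

variable {E : Type*} [NormedAddCommGroup E] [NormedSpace ℝ E]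
  {H : Type*} [TopologicalSpace H]
  {I : ModelWithCorners ℝ E H}
  {G : Type*} [TopologicalSpace G] [ChartedSpace H G]

/-! ### Smoothness of the simplicial maps -/

theorem contMDiff_nerveBarFace (p : ℕ) (i : Fin (p + 2)) :
    ContMDiff (ModelWithCorners.pi fun _ : Fin (p + 1 + 1) => I)
      (ModelWithCorners.pi fun _ : Fin (p + 1) => I) ∞ (nerveBarFace (G := G) p i) :=
  contMDiff_pi_iff.2 fun _ =>
    contMDiff_pi_apply (I := fun _ : Fin (p + 1 + 1) => I) (M := fun _ => G) _

theorem contMDiff_nerveGamma [Group G] [LieGroup I ∞ G] (p : ℕ) :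
    ContMDiff (ModelWithCorners.pi fun _ : Fin (p + 1) => I)
      (ModelWithCorners.pi fun _ : Fin p => I) ∞ (nerveGamma (G := G) p) :=
  contMDiff_pi_iff.2 fun _ =>
    (contMDiff_pi_apply (I := fun _ : Fin (p + 1) => I) (M := fun _ => G) _).mul
      (contMDiff_pi_apply (I := fun _ : Fin (p + 1) => I) (M := fun _ => G) _).inv

end Nerve

/-! ### Components of the total differential that vanish -/

namespace Cochain

variable {E : ℕ → Type*} [∀ p, NormedAddCommGroup (E p)] [∀ p, NormedSpace ℝ (E p)]
  {H : ℕ → Type*} [∀ p, TopologicalSpace (H p)]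
  {I : ∀ p, ModelWithCorners ℝ (E p) (H p)} {X : ℕ → Type*}
  [∀ p, TopologicalSpace (X p)] [∀ p, ChartedSpace (H p) (X p)]

theorem dHor_apply (face : ∀ p, Fin (p + 2) → X (p + 1) → X p) {p q : ℕ}
    (α : DiffForm (I p) (X p) q) (x : X (p + 1)) :
    dHor (I := I) face α x =
      ∑ i : Fin (p + 2), (-1 : ℂ) ^ (i : ℕ) • DiffForm.pullback (face p i) α x := by
  rw [dHor, Finset.sum_apply]
  rfl

theorem dHor_zero (face : ∀ p, Fin (p + 2) → X (p + 1) → X p) {p q : ℕ} :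
    dHor face (0 : DiffForm (I p) (X p) q) = 0 := by
  rw [dHor]
  refine Finset.sum_eq_zero fun i _ => ?_
  rw [DiffForm.pullback_zero]
  funext x
  exact smul_zero (M := ℂ) (A := E (p + 1) [⋀^Fin q]→L[ℝ] ℂ) _

theorem dVert_zero {p q : ℕ} [(I p).Boundaryless] :
    dVert (0 : DiffForm (I p) (X p) q) = 0 := by
  rw [dVert, DiffForm.d_zero]
  funext x
  exact smul_zero (M := ℂ) (A := E p [⋀^Fin (q + 1)]→L[ℝ] ℂ) _

theorem D_zero_succ [(I 0).Boundaryless] (face : ∀ p, Fin (p + 2) → X (p + 1) → X p)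
    {α : Cochain I X} {q : ℕ} (h : α 0 q = 0) : α.D face 0 (q + 1) = 0 := by
  rw [D, h, dVert_zero]

theorem D_succ_zero (face : ∀ p, Fin (p + 2) → X (p + 1) → X p)
    {α : Cochain I X} {p : ℕ} (h : α p 0 = 0) : α.D face (p + 1) 0 = 0 := by
  rw [D, h, dHor_zero]

theorem D_succ_succ {p : ℕ} [(I (p + 1)).Boundaryless]
    (face : ∀ p, Fin (p + 2) → X (p + 1) → X p) {α : Cochain I X} {q : ℕ}
    (h : α p (q + 1) = 0) (h' : α (p + 1) q = 0) : α.D face (p + 1) (q + 1) = 0 := by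
  rw [D, h, h', dHor_zero, dVert_zero]
  exact add_zero _

end Cochain

/-! ### Smoothness and total degree of the two cochains -/

section Cochains

variable {E : Type*} [NormedAddCommGroup E] [NormedSpace ℝ E]
  {H : Type*} [TopologicalSpace H]
  {I : ModelWithCorners ℝ E H} [I.Boundaryless]
  {G : Type*} [TopologicalSpace G] [ChartedSpace H G] [IsManifold I ∞ G]

theorem isTotal_dixmierDouadyCochain {c : DiffForm I G 2}
    {σ : DiffForm (ModelWithCorners.pi fun _ : Fin 2 => I) (Fin 2 → G) 1}
    (hc : c.IsSmooth) (hσ : σ.IsSmooth) : (dixmierDouadyCochain c σ).IsTotal 3 := by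
  refine ⟨fun p q => ?_, fun p q h => ?_⟩
  · rw [DiffForm.isSmooth_iff] at hc hσ ⊢
    intro x
    unfold dixmierDouadyCochain
    split
    · exact (hc _).pullback
        (contMDiff_pi_apply (I := fun _ : Fin 1 => I) (M := fun _ => G) 0 _)
    · exact ((hσ _).smul _).neg
    · exact DiffForm.smoothAt_zero x
  · unfold dixmierDouadyCochain
    split
    · exact absurd rfl h
    · exact absurd rfl h
    · rfl

theorem isTotal_chernSimonsCochain {c : DiffForm I G 2}
    {τ : DiffForm (ModelWithCorners.pi fun _ : Fin (1 + 1) => I) (Fin (1 + 1) → G) 1}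
    (hc : c.IsSmooth) (hτ : τ.IsSmooth) : (chernSimonsCochain c τ).IsTotal 2 := by
  refine ⟨fun p q => ?_, fun p q h => ?_⟩
  · rw [DiffForm.isSmooth_iff] at hc hτ ⊢
    intro x
    unfold chernSimonsCochain
    split
    · exact ((hc _).pullback
        (contMDiff_pi_apply (I := fun _ : Fin (0 + 1) => I) (M := fun _ => G) 0 _)).neg
    · exact ((hτ _).smul _).neg
    · exact DiffForm.smoothAt_zero x
  · unfold chernSimonsCochain
    split
    · exact absurd rfl h
    · exact absurd rfl h
    · rfl

end Cochains

/-! ### Sign bookkeeping and the Chern-Simons identity -/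

namespace CentralExtension

section Signs

variable {V : Type*} [AddCommGroup V] [Module ℂ V]

theorem smul_sum_deltaBarSign (κ : ℂ) (a b c : V) :
    κ • (((deltaBarSign 0 : ℤ) : ℂ) • a + ((deltaBarSign 1 : ℤ) : ℂ) • b +
      ((deltaBarSign 2 : ℤ) : ℂ) • c) = κ • a + κ • b - κ • c := by
  simp only [deltaBarSign, Matrix.cons_val]
  push_cast
  module

/-- Each letter or word stands for the pullback of θ along the corresponding product of lifts. The
terms r, qr and pqr cancel in pairs. -/
theorem alternating_sum_deltaBarSign (p q r pq qr pqr : V) :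
    (((deltaBarSign 0 : ℤ) : ℂ) • r + ((deltaBarSign 1 : ℤ) : ℂ) • q +
        ((deltaBarSign 2 : ℤ) : ℂ) • qr) -
      (((deltaBarSign 0 : ℤ) : ℂ) • r + ((deltaBarSign 1 : ℤ) : ℂ) • pq +
        ((deltaBarSign 2 : ℤ) : ℂ) • pqr) +
      (((deltaBarSign 0 : ℤ) : ℂ) • qr + ((deltaBarSign 1 : ℤ) : ℂ) • p +
        ((deltaBarSign 2 : ℤ) : ℂ) • pqr) =
      ((deltaSign 0 : ℤ) : ℂ) • q + ((deltaSign 1 : ℤ) : ℂ) • pq + ((deltaSign 2 : ℤ) : ℂ) • p := by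
  simp only [deltaBarSign, deltaSign, Matrix.cons_val]
  push_cast
  module

/-- Used with a, b, g the pullbacks of c by ε̄₀, ε̄₁, γ and with k = κ dτ. The factor (-1)¹ of d''
in simplicial degree 1 turns -k into +k. -/
theorem sum_two_faces_eq {a b g k : V} (h : k = a + g - b) :
    (-1 : ℂ) ^ ((0 : Fin 2) : ℕ) • -a + (-1 : ℂ) ^ ((1 : Fin 2) : ℕ) • -b + (-1 : ℂ) ^ 1 • -k =
      g := by
  subst h
  simp only [Fin.val_zero, Fin.val_one]
  module

theorem sum_three_faces_eq (κ : ℂ) {a b c g : V} (h : a - b + c = g) :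
    (-1 : ℂ) ^ ((0 : Fin 3) : ℕ) • -(κ • a) + (-1 : ℂ) ^ ((1 : Fin 3) : ℕ) • -(κ • b) +
      (-1 : ℂ) ^ ((2 : Fin 3) : ℕ) • -(κ • c) = -(κ • g) := by
  subst h
  simp only [Fin.val_zero, Fin.val_one, Fin.val_two]
  module

end Signs

open DiffForm

variable {E : Type*} [NormedAddCommGroup E] [NormedSpace ℝ E]
  {H : Type*} [TopologicalSpace H]
  {E' : Type*} [NormedAddCommGroup E'] [NormedSpace ℝ E']
  {H' : Type*} [TopologicalSpace H']
  {I : ModelWithCorners ℝ E H} {I' : ModelWithCorners ℝ E' H'}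
  {G : Type*} [TopologicalSpace G] [ChartedSpace H G] [Group G]
  {Ghat : Type*} [TopologicalSpace Ghat] [ChartedSpace H' Ghat] [Group Ghat]
  {X : CentralExtension I I' G Ghat}
  [LieGroup I ∞ G] [LieGroup I' ∞ Ghat]
  {θ : DiffForm I' Ghat 1} {c : DiffForm I G 2}
  {σ : DiffForm (ModelWithCorners.pi fun _ : Fin 2 => I) (Fin 2 → G) 1}
  {τ : DiffForm (ModelWithCorners.pi fun _ : Fin (1 + 1) => I) (Fin (1 + 1) → G) 1}

/-! ### The components of the Chern-Simons identity -/

/-- `ε̄₀^* τ - ε̄₁^* τ + ε̄₂^* τ = γ^* σ` on `N̄G(2)`. -/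
theorem alternating_sum_deltaBar (hθ : X.IsConnection θ)
    (hσ : X.IsConnectionPullback (ModelWithCorners.pi fun _ : Fin 2 => I) θ X.deltaSection σ)
    (hτ : X.IsConnectionPullback (ModelWithCorners.pi fun _ : Fin (1 + 1) => I) θ
      X.deltaBarSection τ) (h : Fin (2 + 1) → G) :
    τ.pullback (I := ModelWithCorners.pi fun _ : Fin (2 + 1) => I) (nerveBarFace 1 0) h -
        τ.pullback (I := ModelWithCorners.pi fun _ : Fin (2 + 1) => I) (nerveBarFace 1 1) h +
        τ.pullback (I := ModelWithCorners.pi fun _ : Fin (2 + 1) => I) (nerveBarFace 1 2) h =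
      σ.pullback (I := ModelWithCorners.pi fun _ : Fin (2 + 1) => I) (nerveGamma 2) h := by
  have hpr : ∀ i, ContMDiff (ModelWithCorners.pi fun _ : Fin (2 + 1) => I) I ∞
      (fun y : Fin (2 + 1) → G => y i) := fun i =>
    contMDiff_pi_apply (I := fun _ : Fin (2 + 1) => I) (M := fun _ => G) i
  obtain ⟨U, p, hU, hhU, hp, hρp⟩ := exists_local_lift (X := X) ((hpr 0).mul (hpr 1).inv) h
  obtain ⟨V, q, hV, hhV, hq, hρq⟩ := exists_local_lift (X := X) ((hpr 1).mul (hpr 2).inv) h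
  obtain ⟨W, r, hW, hhW, hr, hρr⟩ := exists_local_lift (X := X) (hpr 2) h
  have hO : IsOpen (U ∩ V ∩ W) := (hU.inter hV).inter hW
  have hh : h ∈ U ∩ V ∩ W := ⟨⟨hhU, hhV⟩, hhW⟩
  replace hp := hp.mono (fun y (hy : y ∈ U ∩ V ∩ W) => hy.1.1)
  replace hq := hq.mono (fun y (hy : y ∈ U ∩ V ∩ W) => hy.1.2)
  replace hr := hr.mono (fun y (hy : y ∈ U ∩ V ∩ W) => hy.2)
  have e₀ := hτ.pullback_eq_sum hθ (contMDiff_nerveBarFace 1 0)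
    (isSmoothLift_deltaBarSection (φ := nerveBarFace 1 0) hO hq hr
      (fun y hy => hρq y hy.1.2) (fun y hy => hρr y hy.2)) hh
  -- The face (h₁, h₃) needs a lift of h₁h₃⁻¹, and pq is one.
  have e₁ := hτ.pullback_eq_sum hθ (contMDiff_nerveBarFace 1 1)
    (isSmoothLift_deltaBarSection (φ := nerveBarFace 1 1) hO (hp.mul hq) hr
      (fun y hy => by
        refine (map_mul X.ρ _ _).trans
          ((congrArg₂ (· * ·) (hρp y hy.1.1) (hρq y hy.1.2)).trans ?_)
        change y 0 * (y 1)⁻¹ * (y 1 * (y 2)⁻¹) = y 0 * (y 2)⁻¹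
        group) (fun y hy => hρr y hy.2)) hh
  -- On the face (h₁, h₂) the entry h₂ is lifted by qr rather than by a new lift, so that only words
  -- in p, q, r occur.
  have e₂ := hτ.pullback_eq_sum hθ (contMDiff_nerveBarFace 1 2)
    (isSmoothLift_deltaBarSection (φ := nerveBarFace 1 2) hO hp (hq.mul hr)
      (fun y hy => hρp y hy.1.1) (fun y hy => by
        refine (map_mul X.ρ _ _).trans
          ((congrArg₂ (· * ·) (hρq y hy.1.2) (hρr y hy.2)).trans ?_)
        exact inv_mul_cancel_right _ _)) hh
  have hassoc : (fun y => p y * (q * r) y) = fun y => p y * q y * r y :=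
    funext fun y => (mul_assoc _ _ _).symm
  rw [hassoc] at e₂
  have e₃ := hσ.pullback_eq_sum hθ (contMDiff_nerveGamma 2)
    (isSmoothLift_deltaSection (φ := nerveGamma 2) hO hp hq
      (fun y hy => hρp y hy.1.1) (fun y hy => hρq y hy.1.2)) hh
  refine (congrArg₂ (· + ·) (congrArg₂ (· - ·) e₀ e₁) e₂).trans (Eq.trans ?_ e₃.symm)
  simp only [Fin.sum_univ_three]
  refine Eq.trans ?_ (alternating_sum_deltaBarSign (V := (Fin (2 + 1) → E) [⋀^Fin 1]→L[ℝ] ℂ)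
    (θ.pullback (I := ModelWithCorners.pi fun _ : Fin (2 + 1) => I) p h)
    (θ.pullback (I := ModelWithCorners.pi fun _ : Fin (2 + 1) => I) q h)
    (θ.pullback (I := ModelWithCorners.pi fun _ : Fin (2 + 1) => I) r h)
    (θ.pullback (I := ModelWithCorners.pi fun _ : Fin (2 + 1) => I) (fun y => p y * q y) h)
    (θ.pullback (I := ModelWithCorners.pi fun _ : Fin (2 + 1) => I) (fun y => q y * r y) h)
    (θ.pullback (I := ModelWithCorners.pi fun _ : Fin (2 + 1) => I)
      (fun y => p y * q y * r y) h))
  rfl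

theorem dHor_deltaBar (hθ : X.IsConnection θ)
    (hσ : X.IsConnectionPullback (ModelWithCorners.pi fun _ : Fin 2 => I) θ X.deltaSection σ)
    (hτ : X.IsConnectionPullback (ModelWithCorners.pi fun _ : Fin (1 + 1) => I) θ
      X.deltaBarSection τ) (κ : ℂ) :
    Cochain.dHor (p := 1) (I := fun p => ModelWithCorners.pi fun _ : Fin (p + 1) => I)
      (X := fun p => Fin (p + 1) → G) nerveBarFace (-(κ • τ)) =
      (-(κ • σ)).pullback (nerveGamma 2) := by
  funext h
  have e := sum_three_faces_eq (V := (Fin (2 + 1) → E) [⋀^Fin 1]→L[ℝ] ℂ) κ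
    (alternating_sum_deltaBar hθ hσ hτ h)
  rw [Cochain.dHor_apply, Fin.sum_univ_three]
  exact e

variable [I.Boundaryless] [I'.Boundaryless]

/-- `κ dτ = ε̄₀^* c + γ^* c - ε̄₁^* c` on `N̄G(1)`. -/
theorem smul_d_deltaBar (hθ : X.IsConnection θ) (hc : X.IsChernForm θ c)
    (hτ : X.IsConnectionPullback (ModelWithCorners.pi fun _ : Fin (1 + 1) => I) θ
      X.deltaBarSection τ) (h : Fin (1 + 1) → G) :
    (-1 / (2 * (Real.pi : ℂ) * Complex.I)) • τ.d h =
      c.pullback (I := ModelWithCorners.pi fun _ : Fin (1 + 1) => I) (fun y => y 1) h +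
        c.pullback (I := ModelWithCorners.pi fun _ : Fin (1 + 1) => I)
          (fun y => y 0 * (y 1)⁻¹) h -
        c.pullback (I := ModelWithCorners.pi fun _ : Fin (1 + 1) => I) (fun y => y 0) h := by
  obtain ⟨V, p, q, hV, hρp, hρq, hl⟩ := exists_isSmoothLift_deltaBarSection (X := X) h
  have hn := hl.isOpen.mem_nhds hV
  have hs : ∀ j, MDifferentiableAt (ModelWithCorners.pi fun _ : Fin (1 + 1) => I) I'
      ((![q, p, fun y => p y * q y] : Fin 3 → (Fin (1 + 1) → G) → Ghat) j) h := fun j =>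
    ((hl.smooth j h hV).contMDiffAt hn).mdifferentiableAt (by simp)
  -- The three components of the lift of the section lie over h₂, h₁h₂⁻¹ and h₁, so κ times the
  -- pullback of dθ along each is the pullback of c by ε̄₀, γ and ε̄₁ respectively.
  have e₁ := hc.pullback_eq (hs 0) (Filter.eventually_of_mem hn hρq)
  have e₂ := hc.pullback_eq (hs 1) (Filter.eventually_of_mem hn hρp)
  have e₃ := hc.pullback_eq (f := fun y => y 0) (hs 2)
    (Filter.eventually_of_mem hn fun y hy => (map_mul X.ρ _ _).trans
      ((congrArg₂ _ (hρp y hy) (hρq y hy)).trans (inv_mul_cancel_right _ _)))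
  rw [e₁, e₂, e₃, hτ.d_eq hθ hl hV, Fin.sum_univ_three]
  exact smul_sum_deltaBarSign (V := (Fin (1 + 1) → E) [⋀^Fin 2]→L[ℝ] ℂ) _ _ _ _

theorem dHor_add_dVert_deltaBar (hθ : X.IsConnection θ) (hc : X.IsChernForm θ c)
    (hτ : X.IsConnectionPullback (ModelWithCorners.pi fun _ : Fin (1 + 1) => I) θ
      X.deltaBarSection τ) :
    Cochain.dHor (p := 0) (I := fun p => ModelWithCorners.pi fun _ : Fin (p + 1) => I)
        (X := fun p => Fin (p + 1) → G) nerveBarFace (-c.pullback (fun y => y 0)) +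
      Cochain.dVert (p := 1) (I := fun p => ModelWithCorners.pi fun _ : Fin (p + 1) => I)
        (X := fun p => Fin (p + 1) → G) (-((-1 / (2 * (Real.pi : ℂ) * Complex.I)) • τ)) =
      (c.pullback (I := ModelWithCorners.pi fun _ : Fin 1 => I) (fun g => g 0)).pullback
        (nerveGamma 1) := by
  have hpr : ContMDiff (ModelWithCorners.pi fun _ : Fin (0 + 1) => I) I ∞
      (fun y : Fin (0 + 1) → G => y 0) :=
    contMDiff_pi_apply (I := fun _ : Fin (0 + 1) => I) (M := fun _ => G) 0
  funext h
  have hτs := isSmooth_iff.1 hτ.smooth h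
  have h₁ : (-((-1 / (2 * (Real.pi : ℂ) * Complex.I)) • τ)).d h =
      -((-1 / (2 * (Real.pi : ℂ) * Complex.I)) • τ.d h) := by
    rw [(hτs.smul _).d_neg, hτs.d_smul]
  have h₂ : ∀ i : Fin 2, (-c.pullback (I := ModelWithCorners.pi fun _ : Fin (0 + 1) => I)
      (fun y : Fin (0 + 1) → G => y 0)).pullback
        (I := ModelWithCorners.pi fun _ : Fin (1 + 1) => I) (nerveBarFace 0 i) h =
      -c.pullback (I := ModelWithCorners.pi fun _ : Fin (1 + 1) => I)
        (fun y => nerveBarFace 0 i y 0) h := by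
    intro i
    rw [pullback_neg, pullback_comp c ((hpr _).mdifferentiableAt (by simp))
      ((contMDiff_nerveBarFace 0 i h).mdifferentiableAt (by simp))]
    rfl
  have h₃ := pullback_comp (x := h) c ((hpr _).mdifferentiableAt (by simp))
    ((contMDiff_nerveGamma (I := I) (G := G) 1 h).mdifferentiableAt (by simp))
  refine Eq.trans ?_ h₃
  have h₄ := Cochain.dHor_apply (p := 0)
    (I := fun p => ModelWithCorners.pi fun _ : Fin (p + 1) => I) (X := fun p => Fin (p + 1) → G)
    nerveBarFace (-c.pullback (fun y => y 0)) h
  rw [Fin.sum_univ_two] at h₄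
  refine (congrArg₂ (· + ·) (h₄.trans (congrArg₂ (· + ·)
    (congrArg ((-1 : ℂ) ^ ((0 : Fin 2) : ℕ) • ·) (h₂ 0))
    (congrArg ((-1 : ℂ) ^ ((1 : Fin 2) : ℕ) • ·) (h₂ 1))))
    (congrArg ((-1 : ℂ) ^ 1 • ·) h₁)).trans ?_
  exact sum_two_faces_eq (V := (Fin (1 + 1) → E) [⋀^Fin 2]→L[ℝ] ℂ) (smul_d_deltaBar hθ hc hτ h)

theorem D_chernSimonsCochain (hθ : X.IsConnection θ) (hc : X.IsChernForm θ c)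
    (hσ : X.IsConnectionPullback (ModelWithCorners.pi fun _ : Fin 2 => I) θ X.deltaSection σ)
    (hτ : X.IsConnectionPullback (ModelWithCorners.pi fun _ : Fin (1 + 1) => I) θ
      X.deltaBarSection τ) :
    (chernSimonsCochain c τ).D nerveBarFace =
      (dixmierDouadyCochain c σ).pullback nerveGamma := by
  have hcs := isSmooth_iff.1 hc.1
  have hpr : ContMDiff (ModelWithCorners.pi fun _ : Fin (0 + 1) => I) I ∞
      (fun y : Fin (0 + 1) → G => y 0) :=
    contMDiff_pi_apply (I := fun _ : Fin (0 + 1) => I) (M := fun _ => G) 0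
  funext p q
  -- From (0,2) and (1,1) the differential reaches only (0,3), (1,2) and (2,1). In every other
  -- bidegree both sides are zero.
  match p, q with
  | 0, 0 => rfl
  | 0, 1 => exact Cochain.D_zero_succ _ rfl
  | 0, 2 => exact Cochain.D_zero_succ _ rfl
  | 0, 3 =>
    funext h
    have h₁ : (-c.pullback (I := ModelWithCorners.pi fun _ : Fin (0 + 1) => I)
        (fun y : Fin (0 + 1) → G => y 0)).d h = 0 := by
      rw [((hcs _).pullback (hpr h)).d_neg, (hcs _).d_pullback (hpr h), hc.d_eq_zero hθ,
        pullback_zero]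
      exact neg_zero (G := (Fin (0 + 1) → E) [⋀^Fin 3]→L[ℝ] ℂ)
    exact (congrArg ((-1 : ℂ) ^ 0 • ·) h₁).trans
      (smul_zero (M := ℂ) (A := (Fin (0 + 1) → E) [⋀^Fin 3]→L[ℝ] ℂ) _)
  | 0, q + 4 => exact Cochain.D_zero_succ _ rfl
  | 1, 0 => exact Cochain.D_succ_zero _ rfl
  | 1, 1 => exact Cochain.D_succ_succ _ rfl rfl
  | 1, 2 => exact dHor_add_dVert_deltaBar hθ hc hτ
  | 1, q + 3 => exact Cochain.D_succ_succ _ rfl rfl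
  | 2, 0 => exact Cochain.D_succ_zero _ rfl
  | 2, 1 =>
    exact (congrArg₂ (· + ·) (dHor_deltaBar hθ hσ hτ _) (Cochain.dVert_zero (p := 2)
      (I := fun p => ModelWithCorners.pi fun _ : Fin (p + 1) => I)
      (X := fun p => Fin (p + 1) → G))).trans (add_zero _)
  | 2, q + 2 => exact Cochain.D_succ_succ _ rfl rfl
  | p + 3, 0 => exact Cochain.D_succ_zero _ rfl
  | p + 3, q + 1 => exact Cochain.D_succ_succ _ rfl rfl

end CentralExtension

end

theorem theorem4p1
    {E : Type*} [NormedAddCommGroup E] [NormedSpace ℝ E] {H : Type*} [TopologicalSpace H]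
    (I : ModelWithCorners ℝ E H) [I.Boundaryless]
    {E' : Type*} [NormedAddCommGroup E'] [NormedSpace ℝ E'] {H' : Type*} [TopologicalSpace H']
    (I' : ModelWithCorners ℝ E' H') [I'.Boundaryless]
    (G : Type*) [TopologicalSpace G] [ChartedSpace H G] [Group G] [LieGroup I ∞ G]
    (Ghat : Type*) [TopologicalSpace Ghat] [ChartedSpace H' Ghat] [Group Ghat] [LieGroup I' ∞ Ghat]
    (X : CentralExtension I I' G Ghat)
    (θ : DiffForm I' Ghat 1) (hθ : X.IsConnection θ) :
    -- the forms `c₁(θ)`, `ŝ^*(δθ)` and `s̄_γ^*(δ̄_γ θ)` are well defined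
    (∃! c : DiffForm I G 2, X.IsChernForm θ c) ∧
    (∃! σ, X.IsConnectionPullback (ModelWithCorners.pi fun _ : Fin 2 => I) θ X.deltaSection σ) ∧
    (∃! τ, X.IsConnectionPullback (ModelWithCorners.pi fun _ : Fin (1 + 1) => I) θ
      X.deltaBarSection τ) ∧
    ∀ c σ τ, X.IsChernForm θ c →
      X.IsConnectionPullback (ModelWithCorners.pi fun _ : Fin 2 => I) θ X.deltaSection σ →
      X.IsConnectionPullback (ModelWithCorners.pi fun _ : Fin (1 + 1) => I) θ
        X.deltaBarSection τ →
      (dixmierDouadyCochain c σ).IsTotal 3 ∧ (chernSimonsCochain c τ).IsTotal 2 ∧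
      (chernSimonsCochain c τ).D nerveBarFace =
        (dixmierDouadyCochain c σ).pullback nerveGamma := by
  refine ⟨hθ.existsUnique_isChernForm,
    hθ.existsUnique_isConnectionPullback CentralExtension.isSmoothSection_deltaSection,
    hθ.existsUnique_isConnectionPullback CentralExtension.isSmoothSection_deltaBarSection,
    fun c σ τ hc hσ hτ => ⟨isTotal_dixmierDouadyCochain hc.1 hσ.smooth,
      isTotal_chernSimonsCochain hc.1 hτ.smooth,
      CentralExtension.D_chernSimonsCochain hθ hc hσ hτ⟩⟩
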